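/- Let $\{f_i,f_i^\dagger\}_{i\in\mathbb Z}$ be charged fermions, $[f_i,f_j^\dagger]_+=\delta_{ij}$, $[f_i,f_j]_+=[f_i^\dagger,f_j^\dagger]_+=0$, acting on the Fock space with vacua $|0\rangle$, $\langle 0|$ such that $f_i|0\rangle=f^\dagger_{-1-i}|0\rangle=0=\langle 0|f_i^\dagger=\langle 0|f_{-1-i}$ for $i<0$ and $\langle 0|0\rangle=1$. Write $:xy:\,=xy-\langle 0|xy|0\rangle$ and $$b_j=\tfrac1{\sqrt2}\big(f_j+(-1)^jf^\dagger_{-j}\big),\qquad \hat b_j=\tfrac{i}{\sqrt2}\big(f_j-(-1)^jf^\dagger_{-j}\big).$$ Relabel the fermions by $\psi=f_0$; $\psi^{(1)}_i=f_{2i+1}$, $\psi^{(2)}_i=f_{2i+2}$ for $i\ge0$; $\psi^{(1)}_i=f_{2i}$, $\psi^{(2)}_i=-f_{2i+1}$ for $i<0$; and likewise for the conjugates $\psi^\dagger,\psi^{\dagger(a)}_i$. Put $$\varphi=\tfrac{1}{\sqrt2}(\psi+\psi^\dagger),\qquad \psi_j=\tfrac1{\sqrt2}\big(\psi^{(1)}_j+\psi^{\dagger(2)}_{-1-j}\big),\qquad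 \psi_j^\dagger=\tfrac1{\sqrt2}\big(\psi^{\dagger(1)}_j+\psi^{(2)}_{-1-j}\big),$$ $$\alpha^{(a)}_k=\sum_{i\in\mathbb Z}:\psi^{(a)}_i\psi^{\dagger(a)}_{i+k}:\quad(a=1,2),\qquad \beta_k=\sum_{i\in\mathbb Z}:\psi_i\psi^\dagger_{i+k}:.$$ Let $\Psi^{\dagger}_n=\psi^\dagger_0\cdots\psi^\dagger_{n-1}$ for $n>0$, $\Psi^\dagger_0=1$, $\Psi^\dagger_n=\psi_{-1}\psi_{-2}\cdots\psi_n$ for $n<0$, and define $\Psi^{\dagger(a)}_n$ in the same way from $\psi^{(a)}_i,\psi^{\dagger(a)}_i$. Set $\langle n,m,0|=\langle 0|\Psi^{\dagger(1)}_n\Psi^{\dagger(2)}_m$, and $\langle n|=\langle 0|\Psi^\dagger_n$ for $n$ even, $\langle n|=\sqrt2\,\langle 0|\varphi\Psi^\dagger_n$ for $n$ odd. Let $h\in B_\infty$ be a group element, that is, a finite product of exponentials $$h=\prod_{l}\exp\Big(\sum_{i,j\in\mathbb Z}a^{(l)}_{ij}:b_ib_j:\Big),\qquad a^{(l)}_{ij}\in\mathbb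 C,$$ where infinitely many $a^{(l)}_{ij}$ may be nonzero as long as every coordinate of $h|0\rangle$ (in the standard basis of Fock space) is given by an absolutely convergent series after expanding the exponentials into monomials in the $:b_ib_j:$. Let $\hat h$ be its image under $b_j\mapsto\hat b_j$, i.e. the same product with $:\hat b_i\hat b_j:$ in place of $:b_ib_j:$, and let $g=h\hat h$. Then the coordinates of $g|0\rangle$ are also absolutely convergent, and for every $n\in\mathbb Z$ the formal power series (the large BKP tau function of $h$ and the two-component KP tau function of $g$) $$\tau^B_n(s)=\langle n|\,e^{\sum_{k\ge1}s_k\beta_k}\,h|0\rangle,\qquad \tau^{(0)}_n(t^{(1)},t^{(2)})=\langle n,-n,0|\,e^{\sum_{k\ge1}(t^{(1)}_k\alpha^{(1)}_k+t^{(2)}_k\alpha^{(2)}_k)}\,g|0\rangle$$ satisfy $$\big(\tau^B_n(s)\big)^2=(-1)^{\frac{n(n-1)}2}\,\tau^{(0)}_n(s,-s).$$ -/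

import Mathlib

noncomputable section

namespace LargeBKP

/-- The fermionic Fock space. The basis vector `single S 1` is the state in which exactly the
modes in the finite set `S` are excited relative to the vacuum; the vacuum is `S = ∅`. -/
abbrev Fock : Type := Finset ℤ →₀ ℂ

/-- Operators on the Fock space; `*` is composition. -/
abbrev Op : Type := Module.End ℂ Fock

/-- The vacuum vector `|0⟩`. -/
def vac : Fock := Finsupp.single ∅ 1

/-- The dual vacuum `⟨0|`: the coefficient of the vacuum vector. -/
def vacBra : Fock →ₗ[ℂ] ℂ := Finsupp.lapply ∅

/-- Exciting the mode `i` (exterior multiplication). -/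
def excite (i : ℤ) : Op :=
  Finsupp.linearCombination ℂ fun S : Finset ℤ =>
    if i ∈ S then 0 else Finsupp.single (insert i S) ((-1 : ℂ) ^ (S.filter (· < i)).card)

/-- Removing the excitation of the mode `i` (contraction). -/
def relax (i : ℤ) : Op :=
  Finsupp.linearCombination ℂ fun S : Finset ℤ =>
    if i ∈ S then Finsupp.single (S.erase i) ((-1 : ℂ) ^ (S.filter (· < i)).card) else 0

/-- The charged fermion `f_i`; it kills the vacuum for `i < 0`. -/
def f (i : ℤ) : Op := if 0 ≤ i then excite i else relax i

/-- The charged fermion `f_i†`; it kills the vacuum for `i ≥ 0`. -/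
def fDag (i : ℤ) : Op := if 0 ≤ i then relax i else excite i

/-- The scalar `1/√2`. -/
def invSqrtTwo : ℂ := ((Real.sqrt 2 : ℝ) : ℂ)⁻¹

/-- The neutral fermion `b_j = (f_j + (-1)^j f_{-j}†)/√2`. -/
def b (j : ℤ) : Op := invSqrtTwo • (f j + ((-1 : ℂ) ^ j) • fDag (-j))

/-- The neutral fermion `b̂_j = i (f_j - (-1)^j f_{-j}†)/√2`. -/
def bHat (j : ℤ) : Op := (Complex.I * invSqrtTwo) • (f j - ((-1 : ℂ) ^ j) • fDag (-j))

/-- Normal ordering of a product of two fermions: `:xy: = xy - ⟨0|xy|0⟩`. -/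
def nord (x y : Op) : Op := x * y - vacBra ((x * y) vac) • (1 : Op)

/-! The relabelled fermions `ψ^(1)`, `ψ^(2)` and their conjugates; the remaining
mode is `ψ = f_0`. -/

def psi1 (i : ℤ) : Op := if 0 ≤ i then f (2 * i + 1) else f (2 * i)

def psi1Dag (i : ℤ) : Op := if 0 ≤ i then fDag (2 * i + 1) else fDag (2 * i)

def psi2 (i : ℤ) : Op := if 0 ≤ i then f (2 * i + 2) else -f (2 * i + 1)

def psi2Dag (i : ℤ) : Op := if 0 ≤ i then fDag (2 * i + 2) else -fDag (2 * i + 1)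

/-! The fermions `φ`, `ψ_j`, `ψ_j†` (up to sign and order they are the `b_j`). -/

def phi : Op := invSqrtTwo • (f 0 + fDag 0)

def psi (j : ℤ) : Op := invSqrtTwo • (psi1 j + psi2Dag (-1 - j))

def psiDag (j : ℤ) : Op := invSqrtTwo • (psi1Dag j + psi2 (-1 - j))

/-- The oscillator `∑_{i ∈ ℤ} :x_i y_{i+k}:`. It is the linear operator whose value on a basis
vector is the sum of the values of the summands; for the fermions used below and `k ≠ 0` only
finitely many of these values are nonzero. -/
def oscillator (x y : ℤ → Op) (k : ℤ) : Op :=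
  Finsupp.linearCombination ℂ fun S : Finset ℤ =>
    ∑ᶠ i : ℤ, nord (x i) (y (i + k)) (Finsupp.single S 1)

/-- `α^(1)_k`. -/
def alpha1 (k : ℤ) : Op := oscillator psi1 psi1Dag k

/-- `α^(2)_k`. -/
def alpha2 (k : ℤ) : Op := oscillator psi2 psi2Dag k

/-- `β_k`. -/
def beta (k : ℤ) : Op := oscillator psi psiDag k

/-- `Ψ_n†` built from fermions `x_i` and their conjugates `y_i`: it is `y_0 y_1 ⋯ y_{n-1}` for
`n > 0`, it is `1` for `n = 0`, and it is `x_{-1} x_{-2} ⋯ x_n` for `n < 0`. -/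
def PsiDag (x y : ℤ → Op) (n : ℤ) : Op :=
  if 0 ≤ n then ((List.range n.toNat).map fun k => y (k : ℤ)).prod
  else ((List.range n.natAbs).map fun k => x (-1 - (k : ℤ))).prod

/-- The left vector `⟨n, m, 0| = ⟨0| Ψ_n†^(1) Ψ_m†^(2)` of the two-component theory. -/
def bra2 (n m : ℤ) : Fock →ₗ[ℂ] ℂ :=
  vacBra ∘ₗ (PsiDag psi1 psi1Dag n * PsiDag psi2 psi2Dag m)

/-- The left vector `⟨n|` of the large BKP theory: `⟨0| Ψ_n†` for even `n` and
`√2 ⟨0| φ Ψ_n†` for odd `n`. -/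
def braB (n : ℤ) : Fock →ₗ[ℂ] ℂ :=
  if Even n then vacBra ∘ₗ PsiDag psi psiDag n
  else vacBra ∘ₗ (((Real.sqrt 2 : ℝ) : ℂ) • (phi * PsiDag psi psiDag n))

/-- The operator-valued formal power series `∑_k t_k H_k`. -/
def linearSeries {σ : Type} (H : σ → Op) : MvPowerSeries σ Op := fun d =>
  open Classical in ∑ k ∈ d.support, if d = Finsupp.single k 1 then H k else 0

/-- The operator-valued formal power series `exp (∑_k t_k H_k) = ∑_N (∑_k t_k H_k)^N / N!`.
As the exponent has no constant term, only `N ≤ |d|` contributes to the monomial `t^d`. -/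
def expSeries {σ : Type} (H : σ → Op) : MvPowerSeries σ Op := fun d =>
  ∑ N ∈ Finset.range (d.degree + 1),
    ((N.factorial : ℂ)⁻¹) • MvPowerSeries.coeff d (linearSeries H ^ N)

/-- One term `(1/k!) a_{i₁j₁} ⋯ a_{i_k j_k} :c_{i₁}c_{j₁}: ⋯ :c_{i_k}c_{j_k}:` of the expansion of
`exp (∑_{i,j} a_{ij} :c_i c_j:)`, indexed by the word `(i₁,j₁), …, (i_k,j_k)`. -/
def expTerm (c : ℤ → Op) (a : ℤ → ℤ → ℂ) (w : List (ℤ × ℤ)) : Op :=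
  ((w.length.factorial : ℂ)⁻¹) • (w.map fun p => a p.1 p.2 • nord (c p.1) (c p.2)).prod

/-- The family of terms of the expanded product
`exp (∑ A⁰_{ij} :c_i c_j:) ⋯ exp (∑ A^{r-1}_{ij} :c_i c_j:)`. For `c = b` this is a general element
`h` of the group `B_∞`; for `c = b̂` it is the image `ĥ` of `h` under `b_j ↦ b̂_j`. Infinitely many
`A^l_{ij}` may be nonzero. -/
def groupElement (c : ℤ → Op) {r : ℕ} (A : Fin r → ℤ → ℤ → ℂ) :
    (Fin r → List (ℤ × ℤ)) → Op := fun w =>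
  (List.ofFn fun l => expTerm c (A l) (w l)).prod

/-- The product of two operators that are given as sums of families. -/
def familyMul {ι κ : Type} (T : ι → Op) (U : κ → Op) : ι × κ → Op := fun p => T p.1 * U p.2

/-- The sum of the family `T`, applied to the vacuum, converges (absolutely) in each coordinate,
i.e. `(∑ T)|0⟩` is a well defined, possibly infinite, combination of basis vectors. -/
def ConvergesOnVacuum {ι : Type} (T : ι → Op) : Prop :=
  ∀ S : Finset ℤ, Summable fun i => T i vac S

/-- The formal power series `⟨u| exp (∑_k t_k H_k) (∑ T) |0⟩` in the variables `t_k`. -/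
def expectation {σ ι : Type} (u : Fock →ₗ[ℂ] ℂ) (H : σ → Op) (T : ι → Op) :
    MvPowerSeries σ ℂ := fun d =>
  ∑' i, u ((MvPowerSeries.coeff d (expSeries H) * T i) vac)

/-- The large BKP tau function `τ^B_n(s) = ⟨n| exp (∑_{k ≥ 1} s_k β_k) h |0⟩`. -/
def tauB {ι : Type} (h : ι → Op) (n : ℤ) : MvPowerSeries ℕ+ ℂ :=
  expectation (braB n) (fun k : ℕ+ => beta ((k : ℕ) : ℤ)) h

/-- The two-component KP tau function
`τ^(0)_n(t^(1), t^(2)) = ⟨n, -n, 0| exp (∑_{k ≥ 1} (t^(1)_k α^(1)_k + t^(2)_k α^(2)_k)) g |0⟩`.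
The variable `inl k` is `t^(1)_k` and `inr k` is `t^(2)_k`. -/
def tau0 {ι : Type} (g : ι → Op) (n : ℤ) : MvPowerSeries (ℕ+ ⊕ ℕ+) ℂ :=
  expectation (bra2 n (-n))
    (Sum.elim (fun k : ℕ+ => alpha1 ((k : ℕ) : ℤ)) (fun k : ℕ+ => alpha2 ((k : ℕ) : ℤ))) g

/-- The substitution `t^(1) = s`, `t^(2) = -s`. -/
def plusMinus : ℕ+ ⊕ ℕ+ → MvPowerSeries ℕ+ ℂ :=
  Sum.elim (fun k => MvPowerSeries.X k) (fun k => -MvPowerSeries.X k)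

end LargeBKP

end

open LargeBKP

noncomputable section
namespace LargeBKP

/-! The charged fermions split into two families of neutral fermions, `b` and `bHat`. They have the
same anticommutators, [b_i, b_j]_+ = (-1)^i δ_{i+j,0}, they anticommute with each other, and each
kills |0⟩ for j < 0 and is killed by ⟨0| for j > 0. An even expectation value is therefore the same
for words in b as for the corresponding words in b̂, and ⟨X Y'⟩ = ⟨X⟩⟨Y'⟩ for X even in the b and Y'
even in the b̂. Both facts follow from one uniqueness statement, `IsWick.eq_zero`: the relations
above determine a functional on words of even length from its value at the empty word.

Three identities put the two-component side into this form. Up to sign, ψ_j and ψ_j† are single b's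
(`psi_eq`, `psiDag_eq`); write ψ̂, β̂ and Ψ̂† for the images under b ↦ b̂. Then α^(1)_k - α^(2)_k =
β_k + β̂_k (`beta_add_betaHat`), where β and β̂ commute, so that at t^(1) = s, t^(2) = -s the
exponential is e^{∑ sβ} e^{∑ sβ̂}. Moreover Ψ†_n Ψ̂†_n = i^n Ψ^†(1)_n Ψ^†(2)_{-n}
(`PsiDag_mul_PsiDag`). Hence i^n τ^(0)_n(s,-s) is an expectation value of a b-part times a b̂-part.
For even n both parts are even and the value is the square of τ^B_n. For odd n both are odd; since
⟨0| b̂_0 b_0 = -(i/2)⟨0|, inserting 2i b̂_0 b_0 at the left makes them even, which accounts for √2 φ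
in ⟨n| and for the remaining factor -i.

Two analytic points remain. The group elements and the oscillators are infinite sums, so the algebra
is done term by term (`braB_mul_braB`) or on a fixed vector, where only finitely many summands act.
The same factorization, applied to the operators that realize the coordinates of Fock space, bounds
the double series for g|0⟩ by products of absolutely convergent series
(`convergesOnVacuum_familyMul`), which justifies the summation. -/

lemma op_neg_mul (A B : Op) : -A * B = -(A * B) := rfl

lemma op_eq_neg_of_add_eq_zero {A B : Op} (h : A + B = 0) : A = -B :=
  LinearMap.ext fun v => eq_neg_of_add_eq_zero_left (LinearMap.congr_fun h v)

/-! ### Canonical anticommutation relations of the charged fermions. -/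

/-- The sign with which the mode `i` is excited or relaxed in the basis state `S`. -/
def modeSign (S : Finset ℤ) (i : ℤ) : ℂ := (-1 : ℂ) ^ (S.filter (· < i)).card

lemma excite_single (i : ℤ) (S : Finset ℤ) :
    excite i (Finsupp.single S 1) =
      if i ∈ S then 0 else Finsupp.single (insert i S) (modeSign S i) := by
  simp [excite, modeSign, Finsupp.linearCombination_single]

lemma relax_single (i : ℤ) (S : Finset ℤ) :
    relax i (Finsupp.single S 1) =
      if i ∈ S then Finsupp.single (S.erase i) (modeSign S i) else 0 := by
  simp [relax, modeSign, Finsupp.linearCombination_single]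

lemma excite_single' (i : ℤ) (S : Finset ℤ) (c : ℂ) :
    excite i (Finsupp.single S c) =
      if i ∈ S then 0 else Finsupp.single (insert i S) (c * modeSign S i) := by
  rw [show Finsupp.single S c = c • Finsupp.single S (1 : ℂ) by simp, map_smul, excite_single]
  split_ifs <;> simp

lemma relax_single' (i : ℤ) (S : Finset ℤ) (c : ℂ) :
    relax i (Finsupp.single S c) =
      if i ∈ S then Finsupp.single (S.erase i) (c * modeSign S i) else 0 := by
  rw [show Finsupp.single S c = c • Finsupp.single S (1 : ℂ) by simp, map_smul, relax_single]
  split_ifs <;> simp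

lemma modeSign_mul_self (S : Finset ℤ) (i : ℤ) : modeSign S i * modeSign S i = 1 := by
  rw [modeSign, ← pow_add, ← two_mul, pow_mul]; simp

lemma modeSign_insert {S : Finset ℤ} {j : ℤ} (hj : j ∉ S) (i : ℤ) :
    modeSign (insert j S) i = if j < i then -modeSign S i else modeSign S i := by
  unfold modeSign
  rw [Finset.filter_insert]
  split_ifs with h
  · rw [Finset.card_insert_of_notMem (by simp [hj]), pow_succ]; ring
  · rfl

lemma modeSign_erase {S : Finset ℤ} {j : ℤ} (hj : j ∈ S) (i : ℤ) :
    modeSign (S.erase j) i = if j < i then -modeSign S i else modeSign S i := by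
  have h := modeSign_insert (Finset.notMem_erase j S) i
  rw [Finset.insert_erase hj] at h
  rw [h]; split_ifs <;> simp

lemma op_ext {A B : Op} (h : ∀ S : Finset ℤ, A (Finsupp.single S 1) = B (Finsupp.single S 1)) :
    A = B := by
  refine Finsupp.lhom_ext' fun S => LinearMap.ext_ring ?_
  simpa using h S

lemma excite_anticomm (i j : ℤ) : excite i * excite j + excite j * excite i = 0 := by
  refine op_ext fun S => ?_
  simp only [LinearMap.add_apply, Module.End.mul_apply, excite_single, LinearMap.zero_apply]
  by_cases hij : i = j
  · subst hij; by_cases h : i ∈ S <;> simp [h, excite_single']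
  by_cases hi : i ∈ S <;> by_cases hj : j ∈ S <;>
    simp [hi, hj, excite_single', hij, Ne.symm hij, modeSign_insert, Finset.insert_comm i j S,
      ← Finsupp.single_add]
  rcases lt_or_gt_of_ne hij with h | h
  · simp [h, h.not_gt]; ring
  · simp [h, h.not_gt]; ring

lemma relax_anticomm (i j : ℤ) : relax i * relax j + relax j * relax i = 0 := by
  refine op_ext fun S => ?_
  simp only [LinearMap.add_apply, Module.End.mul_apply, relax_single, LinearMap.zero_apply]
  by_cases hij : i = j
  · subst hij; by_cases h : i ∈ S <;> simp [h, relax_single']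
  by_cases hi : i ∈ S <;> by_cases hj : j ∈ S <;>
    simp [hi, hj, relax_single', hij, Ne.symm hij, modeSign_erase, Finset.erase_right_comm (a := i),
      ← Finsupp.single_add]
  rcases lt_or_gt_of_ne hij with h | h
  · simp [h, h.not_gt]; ring
  · simp [h, h.not_gt]; ring

lemma relax_excite_anticomm (i j : ℤ) :
    relax i * excite j + excite j * relax i = if i = j then 1 else 0 := by
  refine op_ext fun S => ?_
  by_cases hij : i = j
  · subst hij
    simp only [LinearMap.add_apply, Module.End.mul_apply, relax_single, excite_single, if_true,
      Module.End.one_apply]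
    by_cases h : i ∈ S
    · simp [h, excite_single', modeSign_erase, modeSign_mul_self]
    · simp [h, relax_single', modeSign_insert, modeSign_mul_self]
  · simp only [LinearMap.add_apply, Module.End.mul_apply, relax_single, excite_single, hij, if_false,
      LinearMap.zero_apply]
    by_cases hi : i ∈ S <;> by_cases hj : j ∈ S <;>
      simp [hi, hj, relax_single', excite_single', hij, Ne.symm hij, modeSign_erase, modeSign_insert,
        Finset.erase_insert_of_ne (Ne.symm hij), ← Finsupp.single_add]
    rcases lt_or_gt_of_ne hij with h | h
    · simp [h, h.not_gt]; ring
    · simp [h, h.not_gt]; ring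

lemma excite_relax_anticomm (i j : ℤ) :
    excite i * relax j + relax j * excite i = if i = j then 1 else 0 := by
  rw [add_comm, relax_excite_anticomm]; simp [eq_comm]

lemma f_anticomm (i j : ℤ) : f i * f j + f j * f i = 0 := by
  unfold f
  split_ifs
  · exact excite_anticomm i j
  · rw [excite_relax_anticomm, if_neg (by omega)]
  · rw [relax_excite_anticomm, if_neg (by omega)]
  · exact relax_anticomm i j

lemma fDag_anticomm (i j : ℤ) : fDag i * fDag j + fDag j * fDag i = 0 := by
  unfold fDag
  split_ifs
  · exact relax_anticomm i j
  · rw [relax_excite_anticomm, if_neg (by omega)]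
  · rw [excite_relax_anticomm, if_neg (by omega)]
  · exact excite_anticomm i j

lemma f_fDag_anticomm (i j : ℤ) : f i * fDag j + fDag j * f i = if i = j then 1 else 0 := by
  unfold f fDag
  split_ifs <;> first
    | omega
    | (rw [excite_relax_anticomm]; simp_all)
    | (rw [relax_excite_anticomm]; simp_all)
    | (rw [excite_anticomm])
    | (rw [relax_anticomm])

/-! ### The two mutually anticommuting families of neutral fermions. -/

lemma invSqrtTwo_mul_self : invSqrtTwo * invSqrtTwo = 1 / 2 := by
  unfold invSqrtTwo
  rw [← mul_inv, ← Complex.ofReal_mul, Real.mul_self_sqrt (by norm_num)]; norm_num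

lemma neg_one_zpow_neg (j : ℤ) : (-1 : ℂ) ^ (-j) = (-1) ^ j := by
  rw [zpow_neg, ← inv_zpow]; norm_num

lemma smul_add_smul_anticomm (X X' Y Y' : Op) (a c d e : ℂ) :
    (a • (X + c • X')) * (d • (Y + e • Y')) + (d • (Y + e • Y')) * (a • (X + c • X')) =
      (a * d) • ((X * Y + Y * X) + e • (X * Y' + Y' * X) + c • (Y * X' + X' * Y)
        + (c * e) • (X' * Y' + Y' * X')) := by
  simp only [smul_mul_assoc, mul_smul_comm, mul_add, add_mul, smul_add, smul_smul]
  module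

/-- With c and e left free, one computation serves all three brackets: for i + j = 0 the terms of e
+ c reinforce each other within one family and cancel between b̂ and b. -/
lemma fermion_comb_anticomm (i j : ℤ) (a c d e : ℂ) :
    (a • (f i + c • fDag (-i))) * (d • (f j + e • fDag (-j))) +
      (d • (f j + e • fDag (-j))) * (a • (f i + c • fDag (-i))) =
      (a * d * (if i + j = 0 then e + c else 0)) • 1 := by
  rw [smul_add_smul_anticomm, f_anticomm, fDag_anticomm, f_fDag_anticomm, f_fDag_anticomm]
  by_cases h : i + j = 0
  · rw [if_pos (by omega), if_pos (by omega), if_pos h]; module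
  · rw [if_neg (by omega), if_neg (by omega), if_neg h]; simp

lemma neg_one_zpow_eq_of_add_eq_zero {i j : ℤ} (h : i + j = 0) : (-1 : ℂ) ^ j = (-1) ^ i := by
  rw [show j = -i by omega, neg_one_zpow_neg]

/-- The anticommutator `[b_i, b_j]_+`. -/
def bracket (i j : ℤ) : ℂ := if i + j = 0 then (-1 : ℂ) ^ i else 0

lemma b_anticomm (i j : ℤ) : b i * b j + b j * b i = bracket i j • 1 := by
  unfold b bracket
  rw [fermion_comb_anticomm, invSqrtTwo_mul_self]
  split_ifs with h
  · rw [neg_one_zpow_eq_of_add_eq_zero h]; congr 1; ring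
  · simp

lemma bHat_eq (j : ℤ) :
    bHat j = (Complex.I * invSqrtTwo) • (f j + (-(-1 : ℂ) ^ j) • fDag (-j)) := by
  unfold bHat; module

lemma bHat_anticomm (i j : ℤ) : bHat i * bHat j + bHat j * bHat i = bracket i j • 1 := by
  unfold bracket
  rw [bHat_eq, bHat_eq, fermion_comb_anticomm, mul_mul_mul_comm, invSqrtTwo_mul_self]
  split_ifs with h
  · rw [neg_one_zpow_eq_of_add_eq_zero h, Complex.I_mul_I]; congr 1; ring
  · simp

lemma bHat_b_anticomm (i j : ℤ) : bHat i * b j = -(b j * bHat i) := by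
  apply op_eq_neg_of_add_eq_zero
  unfold b
  rw [bHat_eq, fermion_comb_anticomm]
  split_ifs with h
  · rw [neg_one_zpow_eq_of_add_eq_zero h]; simp
  · simp

/-! ### Vacuum conditions, the zero modes and fermion parity. -/

lemma f_vac {i : ℤ} (hi : i < 0) : f i vac = 0 := by
  simp [f, hi.not_ge, vac, relax_single]

lemma fDag_vac {i : ℤ} (hi : 0 ≤ i) : fDag i vac = 0 := by
  simp [fDag, hi, vac, relax_single]

lemma functional_ext {u v : Fock →ₗ[ℂ] ℂ}
    (h : ∀ S : Finset ℤ, u (Finsupp.single S 1) = v (Finsupp.single S 1)) : u = v := by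
  refine Finsupp.lhom_ext' fun S => LinearMap.ext_ring ?_
  simpa using h S

lemma lapply_comp_excite (T : Finset ℤ) {i : ℤ} (hi : i ∉ T) :
    (Finsupp.lapply T : Fock →ₗ[ℂ] ℂ) ∘ₗ excite i = 0 := by
  refine functional_ext fun S => ?_
  simp only [LinearMap.comp_apply, excite_single, LinearMap.zero_apply, Finsupp.lapply_apply]
  split_ifs with h
  · rfl
  · rw [Finsupp.single_apply, if_neg]
    rintro rfl; simp at hi

lemma lapply_comp_relax_of_mem (T : Finset ℤ) {i : ℤ} (hi : i ∈ T) :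
    (Finsupp.lapply T : Fock →ₗ[ℂ] ℂ) ∘ₗ relax i = 0 := by
  refine functional_ext fun S => ?_
  simp only [LinearMap.comp_apply, relax_single, LinearMap.zero_apply, Finsupp.lapply_apply]
  split_ifs with h
  · rw [Finsupp.single_apply, if_neg]
    rintro rfl; simp at hi
  · rfl

/-- Up to sign, relaxing a mode is the transpose of exciting it. Read backwards, this builds every
coordinate functional from ⟨0|. -/
lemma lapply_comp_relax (T : Finset ℤ) {i : ℤ} (hi : i ∉ T) :
    (Finsupp.lapply T : Fock →ₗ[ℂ] ℂ) ∘ₗ relax i =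
      modeSign T i • Finsupp.lapply (insert i T) := by
  refine functional_ext fun S => ?_
  simp only [LinearMap.comp_apply, relax_single, LinearMap.smul_apply, Finsupp.lapply_apply,
    Finsupp.single_apply]
  by_cases h : S = insert i T
  · subst h; simp [hi, modeSign_insert]
  · rw [if_neg h]
    split_ifs with h1
    · rw [Finsupp.single_apply, if_neg]
      · simp
      · rintro rfl; exact h (Finset.insert_erase h1).symm
    · simp

lemma lapply_comp_excite_of_mem (T : Finset ℤ) {i : ℤ} (hi : i ∈ T) :
    (Finsupp.lapply T : Fock →ₗ[ℂ] ℂ) ∘ₗ excite i =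
      modeSign T i • Finsupp.lapply (T.erase i) := by
  refine functional_ext fun S => ?_
  simp only [LinearMap.comp_apply, excite_single, LinearMap.smul_apply, Finsupp.lapply_apply,
    Finsupp.single_apply]
  by_cases h : S = T.erase i
  · subst h; simp [hi, modeSign_erase]
  · rw [if_neg h]
    split_ifs with h1
    · simp
    · rw [Finsupp.single_apply, if_neg]
      · simp
      · rintro rfl; exact h (Finset.erase_insert h1).symm

lemma vacBra_comp_f {i : ℤ} (hi : 0 ≤ i) : vacBra ∘ₗ f i = 0 := by
  rw [f, if_pos hi]; exact lapply_comp_excite ∅ (by simp)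

lemma vacBra_comp_fDag {i : ℤ} (hi : i < 0) : vacBra ∘ₗ fDag i = 0 := by
  rw [fDag, if_neg hi.not_ge]; exact lapply_comp_excite ∅ (by simp)

lemma b_vac {j : ℤ} (hj : j < 0) : b j vac = 0 := by
  simp [b, f_vac hj, fDag_vac (show 0 ≤ -j by omega)]

lemma bHat_vac {j : ℤ} (hj : j < 0) : bHat j vac = 0 := by
  simp [bHat, f_vac hj, fDag_vac (show 0 ≤ -j by omega)]

lemma vacBra_comp_b {j : ℤ} (hj : 0 < j) : vacBra ∘ₗ b j = 0 := by
  rw [b, LinearMap.comp_smul, LinearMap.comp_add, LinearMap.comp_smul, vacBra_comp_f hj.le,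
    vacBra_comp_fDag (by omega)]; simp

lemma vacBra_comp_bHat {j : ℤ} (hj : 0 < j) : vacBra ∘ₗ bHat j = 0 := by
  rw [bHat, LinearMap.comp_smul, LinearMap.comp_sub, LinearMap.comp_smul, vacBra_comp_f hj.le,
    vacBra_comp_fDag (by omega)]; simp

/-- Since f_0 and f_0† square to zero, b̂_0 b_0 = (i/2)(f_0 f_0† - f_0† f_0). Here ⟨0|f_0 = 0
removes the first term and turns the second into ⟨0|. -/
lemma vacBra_bHat_zero_b_zero (v : Fock) :
    vacBra (bHat 0 (b 0 v)) = -(Complex.I / 2) * vacBra v := by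
  have h1 : ∀ w, vacBra (f 0 w) = 0 := fun w => LinearMap.congr_fun (vacBra_comp_f le_rfl) w
  have h2 : f 0 (f 0 v) = 0 := by
    have := LinearMap.congr_fun (f_anticomm 0 0) v
    simpa [← two_smul ℂ] using this
  have h3 : fDag 0 (fDag 0 v) = 0 := by
    have := LinearMap.congr_fun (fDag_anticomm 0 0) v
    simpa [← two_smul ℂ] using this
  have h4 : f 0 (fDag 0 v) + fDag 0 (f 0 v) = v := by
    have := LinearMap.congr_fun (f_fDag_anticomm 0 0) v
    simpa using this
  have h5 : vacBra (fDag 0 (f 0 v)) = vacBra v := by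
    conv_rhs => rw [← h4, map_add, h1, zero_add]
  simp only [b, bHat, LinearMap.smul_apply, LinearMap.add_apply, LinearMap.sub_apply, map_smul,
    map_add, map_sub, neg_zero, zpow_zero, one_smul, h1, h2, h3, h5, smul_eq_mul]
  linear_combination (-Complex.I * vacBra v) * invSqrtTwo_mul_self

/-- The fermion parity operator. -/
def parityOp : Op := Finsupp.linearCombination ℂ fun S : Finset ℤ =>
  Finsupp.single S ((-1 : ℂ) ^ S.card)

lemma parityOp_single (S : Finset ℤ) (c : ℂ) :
    parityOp (Finsupp.single S c) = (-1 : ℂ) ^ S.card • Finsupp.single S c := by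
  simp [parityOp, Finsupp.linearCombination_single, mul_comm]

lemma parityOp_excite (i : ℤ) : parityOp * excite i = -(excite i * parityOp) := by
  refine op_ext fun S => ?_
  simp only [LinearMap.neg_apply, Module.End.mul_apply, excite_single, parityOp_single, map_smul]
  split_ifs with h
  · simp
  · rw [parityOp_single, Finset.card_insert_of_notMem h, pow_succ]; module

lemma parityOp_relax (i : ℤ) : parityOp * relax i = -(relax i * parityOp) := by
  refine op_ext fun S => ?_
  simp only [LinearMap.neg_apply, Module.End.mul_apply, relax_single, parityOp_single, map_smul]
  split_ifs with h
  · rw [parityOp_single, ← Finset.card_erase_add_one h, pow_succ]; module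
  · simp

lemma parityOp_f (i : ℤ) : parityOp * f i = -(f i * parityOp) := by
  unfold f; split_ifs; exacts [parityOp_excite i, parityOp_relax i]

lemma parityOp_fDag (i : ℤ) : parityOp * fDag i = -(fDag i * parityOp) := by
  unfold fDag; split_ifs; exacts [parityOp_relax i, parityOp_excite i]

lemma parityOp_b (i : ℤ) : parityOp * b i = -(b i * parityOp) := by
  simp only [b, mul_smul_comm, mul_add, parityOp_f, parityOp_fDag, smul_mul_assoc, add_mul]
  module

lemma parityOp_bHat (i : ℤ) : parityOp * bHat i = -(bHat i * parityOp) := by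
  simp only [bHat_eq, mul_smul_comm, mul_add, parityOp_f, parityOp_fDag, smul_mul_assoc, add_mul]
  module

lemma parityOp_vac : parityOp vac = vac := by simp [vac, parityOp_single]

lemma vacBra_parityOp (v : Fock) : vacBra (parityOp v) = vacBra v := by
  suffices vacBra ∘ₗ parityOp = vacBra from LinearMap.congr_fun this v
  refine functional_ext fun S => ?_
  rw [LinearMap.comp_apply, parityOp_single]
  by_cases h : S = ∅
  · subst h; simp
  · simp [vacBra, h]

/-! ### Uniqueness of Wick functionals and factorization of expectation values. -/

section Words

/-- The defining properties of the linear functional `w ↦ ⟨b_w Y⟩` on words. -/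
structure IsWick (H : List ℤ → ℂ) : Prop where
  swap : ∀ u v i j, H (u ++ i :: j :: v) = -H (u ++ j :: i :: v) + bracket i j * H (u ++ v)
  right : ∀ u j, j < 0 → H (u ++ [j]) = 0
  left : ∀ u j, 0 < j → H (j :: u) = 0

/-- The mode j is moved to the right end, where it annihilates the vacuum; each transposition costs
a word shorter by two letters, covered by `ih`. -/
lemma IsWick.eq_zero_of_neg {H : List ℤ → ℂ} (hH : IsWick H) {n : ℕ}
    (ih : ∀ w : List ℤ, w.length = n → H w = 0) {j : ℤ} (hj : j < 0) (v : List ℤ) :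
    ∀ u : List ℤ, u.length + v.length = n + 1 → H (u ++ j :: v) = 0 := by
  induction v with
  | nil => intro u _; exact hH.right u j hj
  | cons i v IH =>
    intro u hu
    simp only [List.length_cons] at hu
    rw [hH.swap, ih (u ++ v) (by simp; omega)]
    have := IH (u ++ [i]) (by simp; omega)
    simp only [List.append_assoc, List.cons_append, List.nil_append] at this
    simp [this]

lemma IsWick.eq_zero_of_pos {H : List ℤ → ℂ} (hH : IsWick H) {n : ℕ}
    (ih : ∀ w : List ℤ, w.length = n → H w = 0) {j : ℤ} (hj : 0 < j) (u : List ℤ) :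
    ∀ v : List ℤ, u.length + v.length = n + 1 → H (u ++ j :: v) = 0 := by
  induction u using List.reverseRecOn with
  | nil => intro v _; exact hH.left v j hj
  | append_singleton u i IH =>
    intro v hv
    simp only [List.length_append, List.length_singleton] at hv
    have := IH (i :: v) (by simp; omega)
    simp only [List.append_assoc, List.cons_append, List.nil_append]
    rw [hH.swap, ih (u ++ v) (by simp; omega), this]; simp

/-- Nonzero modes are moved to the vacuum that they annihilate, so by induction on the length only
words in the mode 0 are left. Even length matters: words of odd length reduce to the single letter
0, whose value H [] does not control. -/
theorem IsWick.eq_zero {H : List ℤ → ℂ} (hH : IsWick H) (h0 : H [] = 0) :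
    ∀ (m : ℕ) (w : List ℤ), w.length = 2 * m → H w = 0 := by
  intro m
  induction m with
  | zero => intro w hw; rw [List.eq_nil_of_length_eq_zero hw, h0]
  | succ m ih =>
    intro w hw
    by_cases hneg : ∃ j ∈ w, j < 0
    · obtain ⟨j, hjw, hj⟩ := hneg
      obtain ⟨u, v, rfl⟩ := List.append_of_mem hjw
      refine hH.eq_zero_of_neg ih hj v u ?_
      simp at hw; omega
    by_cases hpos : ∃ j ∈ w, 0 < j
    · obtain ⟨j, hjw, hj⟩ := hpos
      obtain ⟨u, v, rfl⟩ := List.append_of_mem hjw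
      refine hH.eq_zero_of_pos ih hj u v ?_
      simp at hw; omega
    push Not at hneg hpos
    match w, hw with
    | i :: j :: v, hw =>
      have hi : i = 0 := le_antisymm (hpos i (by simp)) (hneg i (by simp))
      have hj : j = 0 := le_antisymm (hpos j (by simp)) (hneg j (by simp))
      subst hi hj
      -- The relation for two equal letters 0 reads 2 H(0 0 v) = H(v), that is, b_0² = 1/2.
      have h := hH.swap [] v 0 0
      rw [List.nil_append, List.nil_append, ih v (by simp at hw; omega), mul_zero, add_zero] at h
      linear_combination h / 2

/-- The product of the `b_j` over a word. -/
def bWord (w : List ℤ) : Op := (w.map b).prod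

/-- The product of the `b̂_j` over a word. -/
def bHatWord (w : List ℤ) : Op := (w.map bHat).prod

/-- The vacuum expectation value. -/
def vev (X : Op) : ℂ := vacBra (X vac)

lemma bWord_append (u v : List ℤ) : bWord (u ++ v) = bWord u * bWord v := by simp [bWord]

lemma bHatWord_append (u v : List ℤ) : bHatWord (u ++ v) = bHatWord u * bHatWord v := by
  simp [bHatWord]

lemma bWord_cons (j : ℤ) (v : List ℤ) : bWord (j :: v) = b j * bWord v := by simp [bWord]

lemma bHatWord_cons (j : ℤ) (v : List ℤ) : bHatWord (j :: v) = bHat j * bHatWord v := by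
  simp [bHatWord]

lemma bWord_nil : bWord [] = 1 := rfl

lemma bHatWord_nil : bHatWord [] = 1 := rfl

lemma vev_add (X Y : Op) : vev (X + Y) = vev X + vev Y := by simp [vev]

lemma vev_smul (c : ℂ) (X : Op) : vev (c • X) = c * vev X := by simp [vev]

lemma vev_one : vev 1 = 1 := by simp [vev, vac, vacBra]

/-- The spectator Y commutes with all c_j, so an annihilating c_j at the right end of the word
passes through Y and reaches the vacuum. -/
lemma isWick_word {c : ℤ → Op} (hc : ∀ i j, c i * c j + c j * c i = bracket i j • 1)
    (hv : ∀ j < 0, c j vac = 0) (hl : ∀ j, 0 < j → vacBra ∘ₗ c j = 0) {Y : Op}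
    (hY : ∀ j, Commute (c j) Y) : IsWick fun w => vev ((w.map c).prod * Y) where
  swap u v i j := by
    have h : ((u ++ i :: j :: v).map c).prod * Y + ((u ++ j :: i :: v).map c).prod * Y =
        bracket i j • (((u ++ v).map c).prod * Y) := by
      simp only [List.map_append, List.map_cons, List.prod_append, List.prod_cons]
      rw [← add_mul, ← mul_add, ← mul_assoc (c i), ← mul_assoc (c j), ← add_mul, hc]
      simp
    have := congrArg vev h
    rw [vev_add, vev_smul] at this
    linear_combination this
  right u j hj := by
    have h := LinearMap.congr_fun (hY j).eq vac
    simp only [Module.End.mul_apply, hv j hj, map_zero] at h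
    simp [vev, h]
  left u j hj := by
    have h := LinearMap.congr_fun (hl j hj) ((u.map c).prod (Y vac))
    simpa [vev, Module.End.mul_apply] using h

lemma IsWick.sub_smul {G H : List ℤ → ℂ} (hG : IsWick G) (hH : IsWick H) (c : ℂ) :
    IsWick fun w => G w - c * H w where
  swap u v i j := by rw [hG.swap, hH.swap]; ring
  right u j hj := by rw [hG.right u j hj, hH.right u j hj]; ring
  left u j hj := by rw [hG.left u j hj, hH.left u j hj]; ring

lemma isWick_bWord_mul {Y : Op} (hY : ∀ j, Commute (b j) Y) :
    IsWick fun w => vev (bWord w * Y) :=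
  isWick_word b_anticomm (fun _ => b_vac) (fun _ => vacBra_comp_b) hY

lemma isWick_bWord : IsWick fun w => vev (bWord w) := by
  simpa using isWick_bWord_mul (Y := 1) fun j => Commute.one_right _

lemma isWick_bHatWord : IsWick fun w => vev (bHatWord w) := by
  simpa [bHatWord] using isWick_word (Y := 1) bHat_anticomm (fun _ => bHat_vac) (fun _ => vacBra_comp_bHat)
    fun j => Commute.one_right _

/-- Both sides are Wick functionals of w with the value ⟨Y⟩ at the empty word. -/
lemma vev_bWord_mul {Y : Op} (hY : ∀ j, Commute (b j) Y) {w : List ℤ} (hw : Even w.length) :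
    vev (bWord w * Y) = vev (bWord w) * vev Y := by
  obtain ⟨m, hm⟩ := hw
  have := ((isWick_bWord_mul hY).sub_smul isWick_bWord (vev Y)).eq_zero
    (by simp [bWord_nil, vev_one]) m w (by omega)
  linear_combination this

lemma vev_bHatWord {w : List ℤ} (hw : Even w.length) : vev (bHatWord w) = vev (bWord w) := by
  obtain ⟨m, hm⟩ := hw
  have := (isWick_bHatWord.sub_smul isWick_bWord 1).eq_zero
    (by simp [bWord_nil, bHatWord_nil]) m w (by omega)
  linear_combination this

/-- The pairs `(X, X̂)` where `X` is a combination of words in the `b_j` whose length has parity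
`p` and `X̂` is the same combination of words in the `b̂_j`. -/
def hatPairs (p : ZMod 2) : Submodule ℂ (Op × Op) :=
  Submodule.span ℂ {x | ∃ w : List ℤ, (w.length : ZMod 2) = p ∧ x = (bWord w, bHatWord w)}

lemma word_mem_hatPairs (w : List ℤ) : (bWord w, bHatWord w) ∈ hatPairs (w.length : ZMod 2) :=
  Submodule.subset_span ⟨w, rfl, rfl⟩

lemma one_mem_hatPairs : ((1, 1) : Op × Op) ∈ hatPairs 0 := by
  simpa [bWord_nil, bHatWord_nil] using word_mem_hatPairs []

lemma b_mem_hatPairs (j : ℤ) : (b j, bHat j) ∈ hatPairs 1 := by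
  simpa [bWord, bHatWord] using word_mem_hatPairs [j]

lemma smul_mem_hatPairs {p : ZMod 2} (c : ℂ) {X X' : Op} (h : (X, X') ∈ hatPairs p) :
    (c • X, c • X') ∈ hatPairs p := Submodule.smul_mem _ c h

lemma add_mem_hatPairs {p : ZMod 2} {X X' Y Y' : Op} (hX : (X, X') ∈ hatPairs p)
    (hY : (Y, Y') ∈ hatPairs p) : (X + Y, X' + Y') ∈ hatPairs p := Submodule.add_mem _ hX hY

/-- This makes the pairs behave like the graph of a homomorphism X ↦ X̂ that respects the grading by
parity, without having to show that X̂ depends only on X. -/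
lemma mul_mem_hatPairs {p q : ZMod 2} {X X' Y Y' : Op} (hX : (X, X') ∈ hatPairs p)
    (hY : (Y, Y') ∈ hatPairs q) : (X * Y, X' * Y') ∈ hatPairs (p + q) := by
  suffices ∀ x ∈ hatPairs p, ∀ y ∈ hatPairs q, x * y ∈ hatPairs (p + q) from this _ hX _ hY
  intro x hx y hy
  refine Submodule.span_induction₂ (p := fun x y _ _ => x * y ∈ hatPairs (p + q)) ?_ ?_ ?_ ?_ ?_ ?_ ?_
    hx hy
  · rintro _ _ ⟨u, rfl, rfl⟩ ⟨v, rfl, rfl⟩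
    have := word_mem_hatPairs (u ++ v)
    rwa [bWord_append, bHatWord_append, List.length_append, Nat.cast_add] at this
  · intro y _; rw [zero_mul]; exact Submodule.zero_mem _
  · intro x _; rw [mul_zero]; exact Submodule.zero_mem _
  · intro x y z _ _ _ h1 h2; rw [add_mul]; exact Submodule.add_mem _ h1 h2
  · intro x y z _ _ _ h1 h2; rw [mul_add]; exact Submodule.add_mem _ h1 h2
  · intro c x y _ _ h; rw [smul_mul_assoc]; exact Submodule.smul_mem _ _ h
  · intro c x y _ _ h; rw [mul_smul_comm]; exact Submodule.smul_mem _ _ h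

lemma list_prod_mem_hatPairs {ι : Type*} (F G : ι → Op) (p : ZMod 2)
    (h : ∀ i, (F i, G i) ∈ hatPairs p) (l : List ι) :
    ((l.map F).prod, (l.map G).prod) ∈ hatPairs (l.length * p) := by
  induction l with
  | nil => simpa using one_mem_hatPairs
  | cons i l ih =>
    have := mul_mem_hatPairs (h i) ih
    simp only [List.map_cons, List.prod_cons, List.length_cons, Nat.cast_add, Nat.cast_one, add_mul,
      one_mul]
    rwa [add_comm]

lemma hatPairs_induction {p : ZMod 2} {P : Op → Op → Prop}
    (word : ∀ w : List ℤ, (w.length : ZMod 2) = p → P (bWord w) (bHatWord w))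
    (zero : P 0 0) (add : ∀ X X' Y Y', P X X' → P Y Y' → P (X + Y) (X' + Y'))
    (smul : ∀ (c : ℂ) X X', P X X' → P (c • X) (c • X')) {X X' : Op}
    (h : (X, X') ∈ hatPairs p) : P X X' := by
  suffices ∀ x ∈ hatPairs p, P x.1 x.2 from this _ h
  intro x hx
  refine Submodule.span_induction (p := fun x _ => P x.1 x.2) ?_ zero ?_ ?_ hx
  · rintro _ ⟨w, hw, rfl⟩; exact word w hw
  · intro x y _ _ hx hy; exact add _ _ _ _ hx hy
  · intro c x _ hx; exact smul _ _ _ hx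

lemma even_length_of_cast {w : List ℤ} (hw : (w.length : ZMod 2) = 0) : Even w.length :=
  (ZMod.natCast_eq_zero_iff_even).1 hw

lemma vev_hat {X X' : Op} (h : (X, X') ∈ hatPairs 0) : vev X' = vev X := by
  refine hatPairs_induction (P := fun X X' => vev X' = vev X) ?_ rfl ?_ ?_ h
  · intro w hw; exact vev_bHatWord (even_length_of_cast hw)
  · intro X X' Y Y' h1 h2; rw [vev_add, vev_add, h1, h2]
  · intro c X X' h; rw [vev_smul, vev_smul, h]

lemma vev_mul_of_commute {X X' Y : Op} (h : (X, X') ∈ hatPairs 0) (hY : ∀ j, Commute (b j) Y) :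
    vev (X * Y) = vev X * vev Y := by
  refine hatPairs_induction (P := fun X _ => vev (X * Y) = vev X * vev Y) ?_ ?_ ?_ ?_ h
  · intro w hw; exact vev_bWord_mul hY (even_length_of_cast hw)
  · simp [vev]
  · intro X X' Z Z' h1 h2; rw [add_mul, vev_add, vev_add, h1, h2, add_mul]
  · intro c X X' h; rw [smul_mul_assoc, vev_smul, vev_smul, h, mul_assoc]

lemma bHat_mul_bWord (j : ℤ) (w : List ℤ) :
    bHat j * bWord w = (-1 : ℂ) ^ w.length • (bWord w * bHat j) := by
  induction w with
  | nil => simp [bWord]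
  | cons i w ih =>
    rw [bWord_cons, ← mul_assoc, bHat_b_anticomm, op_neg_mul, mul_assoc, ih, List.length_cons,
      pow_succ, mul_smul_comm, mul_assoc]
    module

lemma bHatWord_mul_b (j : ℤ) (w : List ℤ) :
    bHatWord w * b j = (-1 : ℂ) ^ w.length • (b j * bHatWord w) := by
  induction w with
  | nil => simp [bHatWord]
  | cons i w ih =>
    rw [bHatWord_cons, mul_assoc, ih, List.length_cons, pow_succ, mul_smul_comm, ← mul_assoc,
      bHat_b_anticomm, op_neg_mul, mul_assoc]
    module

lemma commute_bHat_of_mem {X X' : Op} (h : (X, X') ∈ hatPairs 0) (j : ℤ) : Commute (bHat j) X := by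
  refine hatPairs_induction (P := fun X _ => Commute (bHat j) X) ?_ (Commute.zero_right _) ?_ ?_ h
  · intro w hw
    have := bHat_mul_bWord j w
    rwa [(even_length_of_cast hw).neg_one_pow, one_smul] at this
  · intro _ _ _ _ h1 h2; exact h1.add_right h2
  · intro c _ _ h; exact h.smul_right c

lemma commute_b_of_mem {X X' : Op} (h : (X, X') ∈ hatPairs 0) (j : ℤ) : Commute (b j) X' := by
  refine hatPairs_induction (P := fun _ X' => Commute (b j) X') ?_ (Commute.zero_right _) ?_ ?_ h
  · intro w hw
    have := bHatWord_mul_b j w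
    rw [(even_length_of_cast hw).neg_one_pow, one_smul] at this
    exact this.symm
  · intro _ _ _ _ h1 h2; exact h1.add_right h2
  · intro c _ _ h; exact h.smul_right c

lemma commute_fst_of_mem {p : ZMod 2} {X X' Y : Op} (h : (X, X') ∈ hatPairs p)
    (hY : ∀ j, Commute (b j) Y) : Commute X Y := by
  refine hatPairs_induction (P := fun X _ => Commute X Y) ?_ (Commute.zero_left _) ?_ ?_ h
  · intro w _
    refine Commute.list_prod_left _ _ fun x hx => ?_
    obtain ⟨j, _, rfl⟩ := List.mem_map.1 hx; exact hY j
  · intro _ _ _ _ h1 h2; exact h1.add_left h2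
  · intro c _ _ h; exact h.smul_left c

lemma commute_snd_of_mem {p : ZMod 2} {X X' Y : Op} (h : (X, X') ∈ hatPairs p)
    (hY : ∀ j, Commute (bHat j) Y) : Commute X' Y := by
  refine hatPairs_induction (P := fun _ X' => Commute X' Y) ?_ (Commute.zero_left _) ?_ ?_ h
  · intro w _
    refine Commute.list_prod_left _ _ fun x hx => ?_
    obtain ⟨j, _, rfl⟩ := List.mem_map.1 hx; exact hY j
  · intro _ _ _ _ h1 h2; exact h1.add_left h2
  · intro c _ _ h; exact h.smul_left c

/-- Expectation values of products of even operators in the `b_j` and the `b̂_j` factorize. -/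
theorem vev_mul_eq {X X₁ X₂ Y Y₁ Y₂ : Op} (hX : (X₁, X₂) ∈ hatPairs 0) (hY : (Y₁, Y₂) ∈ hatPairs 0)
    (hc : ∀ j, Commute (bHat j) X) (hXv : X vac = X₁ vac) (hYv : Y vac = Y₂ vac) :
    vev (X * Y) = vev X₁ * vev Y₁ := by
  have h1 : X (Y vac) = X₁ (Y₂ vac) := by
    rw [hYv, ← Module.End.mul_apply, ← (commute_snd_of_mem hY hc).eq, Module.End.mul_apply, hXv,
      ← Module.End.mul_apply, ← Module.End.mul_apply,
      (commute_fst_of_mem hX (commute_b_of_mem hY)).eq]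
  rw [← vev_hat hY, ← vev_mul_of_commute hX (commute_b_of_mem hY)]
  simp only [vev, Module.End.mul_apply, h1]

lemma parityOp_mul_bWord (w : List ℤ) :
    parityOp * bWord w = (-1 : ℂ) ^ w.length • (bWord w * parityOp) := by
  induction w with
  | nil => simp [bWord]
  | cons i w ih =>
    rw [bWord_cons, ← mul_assoc, parityOp_b, op_neg_mul, mul_assoc, ih, List.length_cons,
      pow_succ, mul_smul_comm, mul_assoc]
    module

lemma parityOp_mul_bHatWord (w : List ℤ) :
    parityOp * bHatWord w = (-1 : ℂ) ^ w.length • (bHatWord w * parityOp) := by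
  induction w with
  | nil => simp [bHatWord]
  | cons i w ih =>
    rw [bHatWord_cons, ← mul_assoc, parityOp_bHat, op_neg_mul, mul_assoc, ih, List.length_cons,
      pow_succ, mul_smul_comm, mul_assoc]
    module

lemma commute_parityOp_of_mem {X X' : Op} (h : (X, X') ∈ hatPairs 0) :
    Commute parityOp X ∧ Commute parityOp X' := by
  refine hatPairs_induction (P := fun X X' => Commute parityOp X ∧ Commute parityOp X') ?_
    ⟨Commute.zero_right _, Commute.zero_right _⟩ ?_ ?_ h
  · intro w hw
    have h1 := parityOp_mul_bWord w
    have h2 := parityOp_mul_bHatWord w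
    rw [(even_length_of_cast hw).neg_one_pow, one_smul] at h1 h2
    exact ⟨h1, h2⟩
  · intro _ _ _ _ h1 h2; exact ⟨h1.1.add_right h2.1, h1.2.add_right h2.2⟩
  · intro c _ _ h; exact ⟨h.1.smul_right c, h.2.smul_right c⟩

/-- Parity fixes both |0⟩ and ⟨0|, so it can be absorbed on either side. -/
lemma vev_eq_zero_of_odd {X : Op} (h : parityOp * X = (-1 : ℂ) • (X * parityOp)) : vev X = 0 := by
  have h1 : vev (parityOp * X) = vev X := vacBra_parityOp _
  have h2 : vev (X * parityOp) = vev X := by simp [vev, parityOp_vac]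
  rw [h, vev_smul, h2] at h1
  linear_combination -h1 / 2

lemma vev_insert_zero_modes (X : Op) : vev X = (2 * Complex.I) * vev (bHat 0 * (b 0 * X)) := by
  simp only [vev, Module.End.mul_apply, vacBra_bHat_zero_b_zero]
  linear_combination vacBra (X vac) * Complex.I_mul_I

/-- Normal ordering is compatible with b ↦ b̂ because the subtracted constants agree by `vev_hat`.
-/
lemma nord_mem_hatPairs (i j : ℤ) :
    (nord (b i) (b j), nord (bHat i) (bHat j)) ∈ hatPairs 0 := by
  have h : (b i * b j, bHat i * bHat j) ∈ hatPairs (1 + 1) :=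
    mul_mem_hatPairs (b_mem_hatPairs i) (b_mem_hatPairs j)
  rw [show (1 + 1 : ZMod 2) = 0 from rfl] at h
  have h1 := vev_hat h
  unfold vev at h1
  have h2 := add_mem_hatPairs h
    (smul_mem_hatPairs (-(vacBra ((b i * b j) vac))) one_mem_hatPairs)
  have h3 (X : Op) (c : ℂ) : X - c • (1 : Op) = X + (-c) • (1 : Op) := by module
  unfold nord
  rw [h1, h3, h3]
  exact h2

lemma expTerm_mem_hatPairs (a : ℤ → ℤ → ℂ) (w : List (ℤ × ℤ)) :
    (expTerm b a w, expTerm bHat a w) ∈ hatPairs 0 := by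
  have := list_prod_mem_hatPairs (fun p : ℤ × ℤ => a p.1 p.2 • nord (b p.1) (b p.2))
    (fun p : ℤ × ℤ => a p.1 p.2 • nord (bHat p.1) (bHat p.2)) 0
    (fun p => smul_mem_hatPairs _ (nord_mem_hatPairs _ _)) w
  rw [mul_zero] at this
  exact smul_mem_hatPairs _ this

lemma groupElement_mem_hatPairs {r : ℕ} (A : Fin r → ℤ → ℤ → ℂ) (w : Fin r → List (ℤ × ℤ)) :
    (groupElement b A w, groupElement bHat A w) ∈ hatPairs 0 := by
  have := list_prod_mem_hatPairs (fun l => expTerm b (A l) (w l))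
    (fun l => expTerm bHat (A l) (w l)) 0 (fun l => expTerm_mem_hatPairs _ _) (List.finRange r)
  rw [mul_zero] at this
  simpa only [groupElement, List.ofFn_eq_map] using this

end Words

/-! ### Coordinate functionals and absolute convergence of g|0⟩. -/

section FiniteFunctionals

/-- The functionals on Fock space which only see finitely many coordinates. -/
def finFunctionals : Submodule ℂ (Fock →ₗ[ℂ] ℂ) :=
  Submodule.span ℂ (Set.range fun S : Finset ℤ => (Finsupp.lapply S : Fock →ₗ[ℂ] ℂ))

lemma lapply_mem_finFunctionals (S : Finset ℤ) :
    (Finsupp.lapply S : Fock →ₗ[ℂ] ℂ) ∈ finFunctionals := Submodule.subset_span ⟨S, rfl⟩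

lemma vacBra_mem_finFunctionals : vacBra ∈ finFunctionals := lapply_mem_finFunctionals ∅

lemma comp_mem_of_lapply_comp_mem {X : Op}
    (h : ∀ S : Finset ℤ, (Finsupp.lapply S : Fock →ₗ[ℂ] ℂ) ∘ₗ X ∈ finFunctionals)
    {u : Fock →ₗ[ℂ] ℂ} (hu : u ∈ finFunctionals) : u ∘ₗ X ∈ finFunctionals := by
  refine Submodule.span_induction (p := fun u _ => u ∘ₗ X ∈ finFunctionals) ?_ ?_ ?_ ?_ hu
  · rintro _ ⟨S, rfl⟩; exact h S
  · rw [LinearMap.zero_comp]; exact Submodule.zero_mem _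
  · intro u v _ _ h1 h2; rw [LinearMap.add_comp]; exact Submodule.add_mem _ h1 h2
  · intro c u _ h; rw [LinearMap.smul_comp]; exact Submodule.smul_mem _ _ h

/-- The operators whose adjoint preserves the functionals which see finitely many coordinates. -/
def rowFinite : Subalgebra ℂ Op where
  carrier := {X | ∀ u ∈ finFunctionals, u ∘ₗ X ∈ finFunctionals}
  mul_mem' {X Y} hX hY u hu := by
    rw [Module.End.mul_eq_comp, ← LinearMap.comp_assoc]; exact hY _ (hX _ hu)
  add_mem' {X Y} hX hY u hu := by
    rw [LinearMap.comp_add]; exact Submodule.add_mem _ (hX _ hu) (hY _ hu)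
  algebraMap_mem' c u hu := by
    rw [Algebra.algebraMap_eq_smul_one, LinearMap.comp_smul]; exact Submodule.smul_mem _ _ hu

lemma mem_rowFinite {X : Op}
    (h : ∀ S : Finset ℤ, (Finsupp.lapply S : Fock →ₗ[ℂ] ℂ) ∘ₗ X ∈ finFunctionals) :
    X ∈ rowFinite := fun _ hu => comp_mem_of_lapply_comp_mem h hu

lemma excite_mem_rowFinite (i : ℤ) : excite i ∈ rowFinite := by
  refine mem_rowFinite fun S => ?_
  by_cases hi : i ∈ S
  · rw [lapply_comp_excite_of_mem S hi]; exact Submodule.smul_mem _ _ (lapply_mem_finFunctionals _)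
  · rw [lapply_comp_excite S hi]; exact Submodule.zero_mem _

lemma relax_mem_rowFinite (i : ℤ) : relax i ∈ rowFinite := by
  refine mem_rowFinite fun S => ?_
  by_cases hi : i ∈ S
  · rw [lapply_comp_relax_of_mem S hi]; exact Submodule.zero_mem _
  · rw [lapply_comp_relax S hi]; exact Submodule.smul_mem _ _ (lapply_mem_finFunctionals _)

lemma f_mem_rowFinite (i : ℤ) : f i ∈ rowFinite := by
  unfold f; split_ifs; exacts [excite_mem_rowFinite i, relax_mem_rowFinite i]

lemma fDag_mem_rowFinite (i : ℤ) : fDag i ∈ rowFinite := by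
  unfold fDag; split_ifs; exacts [relax_mem_rowFinite i, excite_mem_rowFinite i]

lemma b_mem_rowFinite (i : ℤ) : b i ∈ rowFinite :=
  Subalgebra.smul_mem _ (Subalgebra.add_mem _ (f_mem_rowFinite _)
    (Subalgebra.smul_mem _ (fDag_mem_rowFinite _) _)) _

lemma mem_rowFinite_of_mem_hatPairs {p : ZMod 2} {X X' : Op} (h : (X, X') ∈ hatPairs p) :
    X ∈ rowFinite := by
  refine hatPairs_induction (P := fun X _ => X ∈ rowFinite) ?_ (Subalgebra.zero_mem _) ?_ ?_ h
  · intro w _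
    refine Subalgebra.list_prod_mem _ fun x hx => ?_
    obtain ⟨j, _, rfl⟩ := List.mem_map.1 hx; exact b_mem_rowFinite j
  · intro _ _ _ _ h1 h2; exact Subalgebra.add_mem _ h1 h2
  · intro c _ _ h; exact Subalgebra.smul_mem _ h c

lemma vacBra_comp_mem {X : Op} (hX : X ∈ rowFinite) : vacBra ∘ₗ X ∈ finFunctionals :=
  hX _ vacBra_mem_finFunctionals

/-- The span of the products of a word in the `b_j` with a word in the `b̂_j`. -/
def sortedOps : Submodule ℂ Op :=
  Submodule.span ℂ (Set.range fun w : List ℤ × List ℤ => bWord w.1 * bHatWord w.2)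

/-- By linearity, closure of the sorted span under right multiplication by Y is tested on products
of words. -/
lemma mul_mem_sortedOps {Y : Op} (hY : ∀ w w' : List ℤ, bWord w * bHatWord w' * Y ∈ sortedOps)
    {X : Op} (hX : X ∈ sortedOps) : X * Y ∈ sortedOps := by
  refine Submodule.span_induction (p := fun X _ => X * Y ∈ sortedOps) ?_ ?_ ?_ ?_ hX
  · rintro _ ⟨w, rfl⟩; exact hY _ _
  · rw [zero_mul]; exact Submodule.zero_mem _
  · intro u v _ _ h1 h2; rw [add_mul]; exact Submodule.add_mem _ h1 h2
  · intro c u _ h; rw [smul_mul_assoc]; exact Submodule.smul_mem _ _ h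

lemma mul_b_mem_sortedOps (j : ℤ) {X : Op} (hX : X ∈ sortedOps) : X * b j ∈ sortedOps := by
  refine mul_mem_sortedOps (fun w w' => ?_) hX
  rw [mul_assoc, bHatWord_mul_b, mul_smul_comm, ← mul_assoc]
  refine Submodule.smul_mem _ _ (Submodule.subset_span ⟨(w ++ [j], w'), ?_⟩)
  simp [bWord]

lemma mul_bHat_mem_sortedOps (j : ℤ) {X : Op} (hX : X ∈ sortedOps) : X * bHat j ∈ sortedOps := by
  refine mul_mem_sortedOps (fun w w' => ?_) hX
  refine Submodule.subset_span ⟨(w, w' ++ [j]), ?_⟩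
  simp [bHatWord, mul_assoc]

lemma f_eq (j : ℤ) : f j = invSqrtTwo • b j + (-Complex.I * invSqrtTwo) • bHat j := by
  have h : -Complex.I * invSqrtTwo * (Complex.I * invSqrtTwo) = 1 / 2 := by
    linear_combination (-invSqrtTwo * invSqrtTwo) * Complex.I_mul_I + invSqrtTwo_mul_self
  rw [b, bHat_eq, smul_smul, smul_smul, invSqrtTwo_mul_self, h]
  module

lemma fDag_eq (j : ℤ) :
    fDag j = (-1 : ℂ) ^ j • (invSqrtTwo • b (-j) + (Complex.I * invSqrtTwo) • bHat (-j)) := by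
  have h : Complex.I * invSqrtTwo * (Complex.I * invSqrtTwo) = -1 / 2 := by
    linear_combination (invSqrtTwo * invSqrtTwo) * Complex.I_mul_I - invSqrtTwo_mul_self
  have h2 : (-1 : ℂ) ^ j * (-1 : ℂ) ^ j = 1 := by
    rw [← mul_zpow]; norm_num
  rw [b, bHat_eq, smul_smul (Complex.I * _), smul_smul invSqrtTwo, invSqrtTwo_mul_self, h, neg_neg,
    neg_one_zpow_neg]
  have : (1 / 2 : ℂ) • (f (-j) + (-1 : ℂ) ^ j • fDag j) +
      (-1 / 2 : ℂ) • (f (-j) + (-(-1 : ℂ) ^ j) • fDag j) = (-1 : ℂ) ^ j • fDag j := by module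
  rw [this, smul_smul, h2, one_smul]

lemma mul_f_mem_sortedOps (j : ℤ) {X : Op} (hX : X ∈ sortedOps) : X * f j ∈ sortedOps := by
  rw [f_eq, mul_add, mul_smul_comm, mul_smul_comm]
  exact Submodule.add_mem _ (Submodule.smul_mem _ _ (mul_b_mem_sortedOps _ hX))
    (Submodule.smul_mem _ _ (mul_bHat_mem_sortedOps _ hX))

lemma mul_fDag_mem_sortedOps (j : ℤ) {X : Op} (hX : X ∈ sortedOps) : X * fDag j ∈ sortedOps := by
  rw [fDag_eq, mul_smul_comm, mul_add, mul_smul_comm, mul_smul_comm]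
  exact Submodule.smul_mem _ _ (Submodule.add_mem _
    (Submodule.smul_mem _ _ (mul_b_mem_sortedOps _ hX))
    (Submodule.smul_mem _ _ (mul_bHat_mem_sortedOps _ hX)))

lemma mul_relax_mem_sortedOps (j : ℤ) {X : Op} (hX : X ∈ sortedOps) : X * relax j ∈ sortedOps := by
  by_cases h : 0 ≤ j
  · simpa [fDag, h] using mul_fDag_mem_sortedOps j hX
  · simpa [f, h] using mul_f_mem_sortedOps j hX

/-- The coordinate at S is ⟨0| followed by the relaxation of all modes of S. Each relaxation is some
f or f†, hence a combination of b and b̂, and anticommuting the b's to the left sorts the product.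
-/
lemma exists_sortedOps_of_lapply (S : Finset ℤ) :
    ∃ Q ∈ sortedOps, (Finsupp.lapply S : Fock →ₗ[ℂ] ℂ) = vacBra ∘ₗ Q := by
  induction S using Finset.induction_on with
  | empty => exact ⟨1, Submodule.subset_span ⟨([], []), by simp [bWord, bHatWord]⟩, rfl⟩
  | insert i T hi ih =>
    obtain ⟨Q, hQ, h⟩ := ih
    refine ⟨modeSign T i • (Q * relax i), Submodule.smul_mem _ _ (mul_relax_mem_sortedOps i hQ), ?_⟩
    have h1 := lapply_comp_relax T hi
    rw [LinearMap.comp_smul, Module.End.mul_eq_comp, ← LinearMap.comp_assoc, ← h, h1, smul_smul,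
      modeSign_mul_self, one_smul]

/-- Everything made of b is gathered on the left and everything made of b̂ on the right. C and D
stand for coefficients of the exponentials of β and β̂. These are infinite sums and need not belong
to a pair in `hatPairs`, so they enter only through their commutation relations and through the
vectors that they produce, which finite even operators also produce. -/
lemma vev_factor_even {P P' Q Q' C D T T' T₁ T₂ U U₁ U₂ : Op} (hP : (P, P') ∈ hatPairs 0)
    (hQ : (Q, Q') ∈ hatPairs 0) (hC : ∀ j, Commute (bHat j) C) (hD : ∀ j, Commute (b j) D)
    (hT : (T, T') ∈ hatPairs 0) (hT₁ : (T₁, T₂) ∈ hatPairs 0) (hU₁ : (U₁, U₂) ∈ hatPairs 0)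
    (hCT : C (T vac) = T₁ vac) (hDU : D (U vac) = U₂ vac) :
    vev (P * Q' * (C * D) * (T * U)) = vev (P * T₁) * vev (Q * U₁) := by
  have h1 : Q' * C = C * Q' := (commute_snd_of_mem hQ hC).eq
  have h2 : Q' * T = T * Q' := (commute_snd_of_mem hQ (commute_bHat_of_mem hT)).eq
  have h3 : D * T = T * D := (commute_fst_of_mem hT hD).symm.eq
  have h4 : P * Q' * (C * D) * (T * U) = (P * C * T) * (Q' * D * U) := by
    calc P * Q' * (C * D) * (T * U) = P * (Q' * C) * (D * T) * U := by simp only [mul_assoc]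
      _ = P * C * (Q' * T) * D * U := by rw [h1, h3]; simp only [mul_assoc]
      _ = _ := by rw [h2]; simp only [mul_assoc]
  rw [h4]
  have hP1 := mul_mem_hatPairs hP hT₁
  have hQ1 := mul_mem_hatPairs hQ hU₁
  rw [add_zero] at hP1 hQ1
  refine vev_mul_eq hP1 hQ1 (fun j => ?_) ?_ ?_
  · exact ((commute_bHat_of_mem hP j).mul_right (hC j)).mul_right (commute_bHat_of_mem hT j)
  · simp only [Module.End.mul_apply, hCT]
  · simp only [Module.End.mul_apply, hDU]

/-- Inserting 2i b̂_0 b_0 next to ⟨0| makes b_0 P even, so b̂_0 passes through it without a sign and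
joins Q'. This reduces to the even case. -/
lemma vev_factor_odd {P P' Q Q' C D T T' T₁ T₂ U U₁ U₂ : Op} (hP : (P, P') ∈ hatPairs 1)
    (hQ : (Q, Q') ∈ hatPairs 1) (hC : ∀ j, Commute (bHat j) C) (hD : ∀ j, Commute (b j) D)
    (hT : (T, T') ∈ hatPairs 0) (hT₁ : (T₁, T₂) ∈ hatPairs 0) (hU₁ : (U₁, U₂) ∈ hatPairs 0)
    (hCT : C (T vac) = T₁ vac) (hDU : D (U vac) = U₂ vac) :
    vev (P * Q' * (C * D) * (T * U)) =
      2 * Complex.I * (vev (b 0 * P * T₁) * vev (b 0 * Q * U₁)) := by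
  have hP1 := mul_mem_hatPairs (b_mem_hatPairs 0) hP
  have hQ1 := mul_mem_hatPairs (b_mem_hatPairs 0) hQ
  rw [show (1 + 1 : ZMod 2) = 0 from rfl] at hP1 hQ1
  rw [← vev_factor_even hP1 hQ1 hC hD hT hT₁ hU₁ hCT hDU, vev_insert_zero_modes]
  have h : bHat 0 * (b 0 * (P * Q' * (C * D) * (T * U))) =
      bHat 0 * (b 0 * P) * (Q' * (C * D) * (T * U)) := by simp only [mul_assoc]
  rw [h, (commute_bHat_of_mem hP1 0).eq]
  simp only [mul_assoc]

lemma ConvergesOnVacuum.summable {ι : Type} {T : ι → Op} (hT : ConvergesOnVacuum T)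
    {u : Fock →ₗ[ℂ] ℂ} (hu : u ∈ finFunctionals) : Summable fun i => u (T i vac) := by
  refine Submodule.span_induction (p := fun u _ => Summable fun i => u (T i vac)) ?_ ?_ ?_ ?_ hu
  · rintro _ ⟨S, rfl⟩; exact hT S
  · exact summable_zero
  · intro u v _ _ h1 h2; exact h1.add h2
  · intro c u _ h; exact h.mul_left c

lemma summable_mul {ι κ : Type} {F : ι → ℂ} {G : κ → ℂ} (hF : Summable F) (hG : Summable G) :
    Summable fun p : ι × κ => F p.1 * G p.2 :=
  summable_mul_of_summable_norm hF.norm hG.norm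

lemma parityOp_mul_word_mul (w w' : List ℤ) {X : Op} (hX : Commute parityOp X) :
    parityOp * (bWord w * bHatWord w' * X) =
      (-1 : ℂ) ^ (w.length + w'.length) • (bWord w * bHatWord w' * X * parityOp) := by
  rw [← mul_assoc, ← mul_assoc, parityOp_mul_bWord, smul_mul_assoc, mul_assoc (bWord w),
    parityOp_mul_bHatWord, mul_smul_comm, smul_mul_assoc, smul_mul_assoc, smul_smul,
    ← pow_add, mul_assoc (bWord w),
    mul_assoc (bHatWord w'), hX.eq]
  simp only [mul_assoc]

/-- The expectation value splits into one factor for each index. Both factors are values on T,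
because the hatted factor equals its unhatted counterpart; convergence for T alone suffices. -/
lemma summable_vev_word {ι : Type} {T T' : ι → Op} (hT : ConvergesOnVacuum T)
    (hp : ∀ i, (T i, T' i) ∈ hatPairs 0) (w w' : List ℤ) :
    Summable fun p : ι × ι => vev (bWord w * bHatWord w' * (T p.1 * T' p.2)) := by
  have hs (X : Op) (hX : X ∈ rowFinite) : Summable fun i => vev (X * T i) := by
    have := hT.summable (vacBra_comp_mem hX)
    simpa only [vev, Module.End.mul_apply, LinearMap.comp_apply] using this
  have hw := word_mem_hatPairs w
  have hw' := word_mem_hatPairs w'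
  have key : ∀ x : ZMod 2, x = 0 ∨ x = 1 := by decide
  rcases key w.length with h | h <;> rcases key w'.length with h' | h' <;> rw [h] at hw <;>
    rw [h'] at hw'
  · have h1 := hs _ (mem_rowFinite_of_mem_hatPairs hw)
    have h2 := hs _ (mem_rowFinite_of_mem_hatPairs hw')
    refine (summable_mul h1 h2).congr fun p => ?_
    have := vev_factor_even hw hw' (C := 1) (D := 1) (U := T' p.2) (fun j => Commute.one_right _)
      (fun j => Commute.one_right _) (hp p.1) (hp p.1) (hp p.2) rfl rfl
    rw [← this, one_mul, mul_one]
  -- Words of opposite parity give an odd operator, so every term vanishes.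
  · refine summable_zero.congr fun p => ?_
    refine (vev_eq_zero_of_odd ?_).symm
    rw [parityOp_mul_word_mul _ _ ((commute_parityOp_of_mem (hp p.1)).1.mul_right
      (commute_parityOp_of_mem (hp p.2)).2), Odd.neg_one_pow]
    rw [← ZMod.natCast_eq_one_iff_odd, Nat.cast_add, h, h', zero_add]
  · refine summable_zero.congr fun p => ?_
    refine (vev_eq_zero_of_odd ?_).symm
    rw [parityOp_mul_word_mul _ _ ((commute_parityOp_of_mem (hp p.1)).1.mul_right
      (commute_parityOp_of_mem (hp p.2)).2), Odd.neg_one_pow]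
    rw [← ZMod.natCast_eq_one_iff_odd, Nat.cast_add, h, h', add_zero]
  · refine ((summable_mul (hs _ (Subalgebra.mul_mem _ (b_mem_rowFinite 0)
      (mem_rowFinite_of_mem_hatPairs hw))) (hs _ (Subalgebra.mul_mem _ (b_mem_rowFinite 0)
      (mem_rowFinite_of_mem_hatPairs hw')))).mul_left (2 * Complex.I)).congr fun p => ?_
    have := vev_factor_odd hw hw' (C := 1) (D := 1) (U := T' p.2) (fun j => Commute.one_right _)
      (fun j => Commute.one_right _) (hp p.1) (hp p.1) (hp p.2) rfl rfl
    rw [← this, one_mul, mul_one]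

lemma convergesOnVacuum_familyMul {ι : Type} {T T' : ι → Op} (hT : ConvergesOnVacuum T)
    (hp : ∀ i, (T i, T' i) ∈ hatPairs 0) : ConvergesOnVacuum (familyMul T T') := by
  intro S
  obtain ⟨Q, hQ, h⟩ := exists_sortedOps_of_lapply S
  suffices Summable fun p : ι × ι => vev (Q * (T p.1 * T' p.2)) from
    this.congr fun p => (LinearMap.congr_fun h ((T p.1 * T' p.2) vac)).symm
  refine Submodule.span_induction
    (p := fun Q _ => Summable fun p : ι × ι => vev (Q * (T p.1 * T' p.2))) ?_ ?_ ?_ ?_ hQ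
  · rintro _ ⟨w, rfl⟩; exact summable_vev_word hT hp w.1 w.2
  · simp [vev]
  · intro P Q _ _ h1 h2; exact (h1.add h2).congr fun p => by rw [add_mul, vev_add]
  · intro c P _ h; exact (h.mul_left c).congr fun p => by rw [smul_mul_assoc, vev_smul]

end FiniteFunctionals

/-! ### Oscillators as locally finite sums. -/

section Oscillators

open Filter

/-- Families of fermions `x_i` and conjugates `y_i` for which the sums `∑_i x_i y_{i+k}`, `k > 0`,
are locally finite and need no normal ordering. -/
structure IsFermionPair (x y : ℤ → Op) : Prop where
  anticomm : ∀ i j, i ≠ j → x i * y j + y j * x i = 0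
  left_vac : ∀ i, i < 0 → x i vac = 0
  right_vac : ∀ i, 0 ≤ i → y i vac = 0
  left_atBot : ∀ v, ∀ᶠ i in atBot, x i v = 0
  right_atTop : ∀ v, ∀ᶠ i in atTop, y i v = 0
  left_atTop : ∀ S, ∀ᶠ i in atTop, (Finsupp.lapply S : Fock →ₗ[ℂ] ℂ) ∘ₗ x i = 0
  right_atBot : ∀ S, ∀ᶠ i in atBot, (Finsupp.lapply S : Fock →ₗ[ℂ] ℂ) ∘ₗ y i = 0
  left_rowFinite : ∀ i, x i ∈ rowFinite
  right_rowFinite : ∀ i, y i ∈ rowFinite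

lemma finite_support_of_eventually {M : Type*} [Zero M] {F : ℤ → M}
    (h1 : ∀ᶠ i in atBot, F i = 0) (h2 : ∀ᶠ i in atTop, F i = 0) : F.support.Finite := by
  have h : ∀ᶠ i in cofinite, F i = 0 := by
    rw [Int.cofinite_eq]; exact Filter.mem_sup.2 ⟨h1, h2⟩
  exact h

namespace IsFermionPair

lemma mul_eq {x y : ℤ → Op} (h : IsFermionPair x y) {i j : ℤ} (hij : i ≠ j) :
    x i * y j = (-1 : ℂ) • (y j * x i) := by
  rw [op_eq_neg_of_add_eq_zero (h.anticomm i j hij)]; module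

/-- For k > 0, either i + k ≥ 0 and y_{i+k} kills the vacuum, or i < i + k < 0 and x_i does after
anticommuting past y_{i+k}. -/
lemma nord_eq {x y : ℤ → Op} (h : IsFermionPair x y) {k : ℤ} (hk : 0 < k) (i : ℤ) :
    nord (x i) (y (i + k)) = x i * y (i + k) := by
  have : (x i * y (i + k)) vac = 0 := by
    by_cases hi : 0 ≤ i + k
    · rw [Module.End.mul_apply, h.right_vac _ hi, map_zero]
    · rw [h.mul_eq (by omega), LinearMap.smul_apply, Module.End.mul_apply,
        h.left_vac _ (by omega), map_zero, smul_zero]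
  rw [nord, this, map_zero, zero_smul]; module

lemma finite_support {x y : ℤ → Op} (h : IsFermionPair x y) {k : ℤ} (hk : 0 < k) (v : Fock) :
    (Function.support fun i => (x i * y (i + k)) v).Finite := by
  refine finite_support_of_eventually ?_ ?_
  · filter_upwards [h.left_atBot v] with i hi
    rw [h.mul_eq (by omega), LinearMap.smul_apply, Module.End.mul_apply, hi, map_zero, smul_zero]
  · filter_upwards [(tendsto_atTop_add_const_right _ k tendsto_id).eventually (h.right_atTop v)]
      with i hi
    rw [Module.End.mul_apply]
    exact (congrArg (x i) hi).trans (map_zero _)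

lemma finite_support_functional {x y : ℤ → Op} (h : IsFermionPair x y) {k : ℤ} (hk : 0 < k)
    (S : Finset ℤ) :
    (Function.support fun i => (Finsupp.lapply S : Fock →ₗ[ℂ] ℂ) ∘ₗ (x i * y (i + k))).Finite := by
  refine finite_support_of_eventually ?_ ?_
  · filter_upwards [(tendsto_atBot_add_const_right _ k tendsto_id).eventually (h.right_atBot S)]
      with i hi
    rw [h.mul_eq (by omega), LinearMap.comp_smul, Module.End.mul_eq_comp, ← LinearMap.comp_assoc]
    change (-1 : ℂ) • (((Finsupp.lapply S : Fock →ₗ[ℂ] ℂ) ∘ₗ y (id i + k)) ∘ₗ x i) = 0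
    rw [hi, LinearMap.zero_comp, smul_zero]
  · filter_upwards [h.left_atTop S] with i hi
    rw [Module.End.mul_eq_comp, ← LinearMap.comp_assoc, hi, LinearMap.zero_comp]

lemma oscillator_apply {x y : ℤ → Op} (h : IsFermionPair x y) {k : ℤ} (hk : 0 < k) (v : Fock) :
    oscillator x y k v = ∑ᶠ i, (x i * y (i + k)) v := by
  induction v using Finsupp.induction_linear with
  | zero => simp
  | add v w hv hw =>
    rw [map_add, hv, hw, ← finsum_add_distrib (h.finite_support hk v) (h.finite_support hk w)]
    simp
  | single S c =>
    rw [show Finsupp.single S c = c • Finsupp.single S (1 : ℂ) by simp]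
    simp only [map_smul, oscillator, Finsupp.linearCombination_single, one_smul, h.nord_eq hk]
    exact smul_finsum c _

lemma oscillator_apply_eq_sum {x y : ℤ → Op} (h : IsFermionPair x y) {k : ℤ} (hk : 0 < k)
    (v : Fock) {K : Finset ℤ} (hK : (h.finite_support hk v).toFinset ⊆ K) :
    oscillator x y k v = (∑ i ∈ K, x i * y (i + k)) v := by
  rw [h.oscillator_apply hk, finsum_eq_sum_of_support_subset (s := K), LinearMap.sum_apply]
  simpa using hK

lemma commute_oscillator {x y : ℤ → Op} (h : IsFermionPair x y) {k : ℤ} (hk : 0 < k) {Z : Op}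
    (hZ : ∀ i, Commute Z (x i * y (i + k))) : Commute Z (oscillator x y k) := by
  refine LinearMap.ext fun v => ?_
  rw [Module.End.mul_apply, Module.End.mul_apply, h.oscillator_apply hk, h.oscillator_apply hk]
  have := (Z : Fock →ₗ[ℂ] Fock).toAddMonoidHom.map_finsum (h.finite_support hk v)
  refine this.trans (finsum_congr fun i => ?_)
  exact LinearMap.congr_fun (hZ i).eq v

/-- Not only a vector but also a coordinate functional meets just finitely many summands. Hence the
oscillator can be moved onto the bra, where coordinatewise convergence of h|0⟩ is enough. -/
lemma oscillator_mem_rowFinite {x y : ℤ → Op} (h : IsFermionPair x y) {k : ℤ} (hk : 0 < k) :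
    oscillator x y k ∈ rowFinite := by
  refine mem_rowFinite fun S => ?_
  set K := (h.finite_support_functional hk S).toFinset with hK
  have h1 : (Finsupp.lapply S : Fock →ₗ[ℂ] ℂ) ∘ₗ oscillator x y k =
      ∑ i ∈ K, (Finsupp.lapply S : Fock →ₗ[ℂ] ℂ) ∘ₗ (x i * y (i + k)) := by
    refine LinearMap.ext fun v => ?_
    rw [LinearMap.comp_apply, h.oscillator_apply hk, LinearMap.sum_apply]
    have h2 := (Finsupp.lapply S : Fock →ₗ[ℂ] ℂ).toAddMonoidHom.map_finsum (h.finite_support hk v)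
    refine h2.trans (finsum_eq_sum_of_support_subset (s := K) _ fun i hi => ?_)
    rw [hK, Set.Finite.coe_toFinset]
    intro h3
    exact hi (LinearMap.congr_fun h3 v)
  rw [h1]
  exact Submodule.sum_mem _ fun i _ => Subalgebra.mul_mem _ (h.left_rowFinite _)
    (h.right_rowFinite _) _ (lapply_mem_finFunctionals S)

end IsFermionPair

lemma eventually_f_apply (v : Fock) : ∀ᶠ i in atBot, f i v = 0 := by
  induction v using Finsupp.induction_linear with
  | zero => simp
  | add v w hv hw => filter_upwards [hv, hw] with i h1 h2; rw [map_add, h1, h2, add_zero]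
  | single S c =>
    have hS : ∀ᶠ i in atBot, i ∉ S := by
      have := S.finite_toSet.compl_mem_cofinite
      rw [Int.cofinite_eq] at this
      exact this.1
    filter_upwards [hS, eventually_lt_atBot 0] with i h1 h2
    simp [f, h2.not_ge, relax_single', h1]

lemma eventually_fDag_apply (v : Fock) : ∀ᶠ i in atTop, fDag i v = 0 := by
  induction v using Finsupp.induction_linear with
  | zero => simp
  | add v w hv hw => filter_upwards [hv, hw] with i h1 h2; rw [map_add, h1, h2, add_zero]
  | single S c =>
    have hS : ∀ᶠ i in atTop, i ∉ S := by
      have := S.finite_toSet.compl_mem_cofinite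
      rw [Int.cofinite_eq] at this
      exact this.2
    filter_upwards [hS, eventually_ge_atTop 0] with i h1 h2
    simp [fDag, h2, relax_single', h1]

lemma eventually_lapply_comp_f (S : Finset ℤ) :
    ∀ᶠ i in atTop, (Finsupp.lapply S : Fock →ₗ[ℂ] ℂ) ∘ₗ f i = 0 := by
  have hS : ∀ᶠ i in atTop, i ∉ S := by
    have := S.finite_toSet.compl_mem_cofinite
    rw [Int.cofinite_eq] at this
    exact this.2
  filter_upwards [hS, eventually_ge_atTop 0] with i h1 h2
  rw [f, if_pos h2, lapply_comp_excite S h1]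

lemma eventually_lapply_comp_fDag (S : Finset ℤ) :
    ∀ᶠ i in atBot, (Finsupp.lapply S : Fock →ₗ[ℂ] ℂ) ∘ₗ fDag i = 0 := by
  have hS : ∀ᶠ i in atBot, i ∉ S := by
    have := S.finite_toSet.compl_mem_cofinite
    rw [Int.cofinite_eq] at this
    exact this.1
  filter_upwards [hS, eventually_lt_atBot 0] with i h1 h2
  rw [fDag, if_neg h2.not_ge, lapply_comp_excite S h1]

lemma eventually_comb_apply (a : ℂ) (c : ℤ → ℂ) (v : Fock) :
    ∀ᶠ i in atBot, (a • (f i + c i • fDag (-i))) v = 0 := by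
  filter_upwards [eventually_f_apply v,
    tendsto_neg_atBot_atTop.eventually (eventually_fDag_apply v)] with i h1 h2
  simp [h1, h2]

lemma eventually_lapply_comp_comb (a : ℂ) (c : ℤ → ℂ) (S : Finset ℤ) :
    ∀ᶠ i in atTop, (Finsupp.lapply S : Fock →ₗ[ℂ] ℂ) ∘ₗ (a • (f i + c i • fDag (-i))) = 0 := by
  filter_upwards [eventually_lapply_comp_f S,
    tendsto_neg_atTop_atBot.eventually (eventually_lapply_comp_fDag S)] with i h1 h2
  rw [LinearMap.comp_smul, LinearMap.comp_add, LinearMap.comp_smul, h1, h2]; simp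

/-! ### The relabelled fermions and the splitting of the oscillators. -/

/-- The label of the fermion `f_j` which is renamed to `ψ^(1)_i`. -/
def label1 (i : ℤ) : ℤ := if 0 ≤ i then 2 * i + 1 else 2 * i

/-- The label of the fermion `f_j` which is renamed, up to sign, to `ψ^(2)_i`. -/
def label2 (i : ℤ) : ℤ := if 0 ≤ i then 2 * i + 2 else 2 * i + 1

/-- The labels in a relabelling of fermions that preserves the order and the vacuum. -/
structure IsLabelling (m : ℤ → ℤ) : Prop where
  injective : Function.Injective m
  pos : ∀ i, 0 ≤ i → i < m i
  neg : ∀ i, i < 0 → m i < 0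
  le : ∀ i, i < -1 → m i ≤ i

lemma isLabelling_label1 : IsLabelling label1 where
  injective i j h := by unfold label1 at h; split_ifs at h <;> omega
  pos i h := by unfold label1; split_ifs; omega
  neg i h := by unfold label1; split_ifs <;> omega
  le i h := by unfold label1; split_ifs <;> omega

lemma isLabelling_label2 : IsLabelling label2 where
  injective i j h := by unfold label2 at h; split_ifs at h <;> omega
  pos i h := by unfold label2; split_ifs; omega
  neg i h := by unfold label2; split_ifs <;> omega
  le i h := by unfold label2; split_ifs <;> omega

lemma IsLabelling.tendsto_atTop {m : ℤ → ℤ} (hm : IsLabelling m) : Tendsto m atTop atTop := by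
  refine tendsto_atTop_mono' _ ?_ tendsto_id
  filter_upwards [eventually_ge_atTop 0] with i hi using (hm.pos i hi).le

lemma IsLabelling.tendsto_atBot {m : ℤ → ℤ} (hm : IsLabelling m) : Tendsto m atBot atBot := by
  refine tendsto_atBot_mono' _ ?_ tendsto_id
  filter_upwards [eventually_lt_atBot (-1)] with i hi using hm.le i hi

lemma isFermionPair_f {m : ℤ → ℤ} (hm : IsLabelling m) (s : ℤ → ℂ) :
    IsFermionPair (fun i => s i • f (m i)) (fun i => s i • fDag (m i)) where
  anticomm i j hij := by
    have h := f_fDag_anticomm (m i) (m j)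
    rw [if_neg (hm.injective.ne hij)] at h
    simp only [smul_mul_assoc, mul_smul_comm]
    rw [smul_comm (s j) (s i), ← smul_add, ← smul_add, h, smul_zero, smul_zero]
  left_vac i hi := by simp [f_vac (hm.neg i hi)]
  right_vac i hi := by simp [fDag_vac (hi.trans (hm.pos i hi).le)]
  left_atBot v := by
    filter_upwards [hm.tendsto_atBot.eventually (eventually_f_apply v)] with i hi
    simp [hi]
  right_atTop v := by
    filter_upwards [hm.tendsto_atTop.eventually (eventually_fDag_apply v)] with i hi
    simp [hi]
  left_atTop S := by
    filter_upwards [hm.tendsto_atTop.eventually (eventually_lapply_comp_f S)] with i hi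
    rw [LinearMap.comp_smul, hi, smul_zero]
  right_atBot S := by
    filter_upwards [hm.tendsto_atBot.eventually (eventually_lapply_comp_fDag S)] with i hi
    rw [LinearMap.comp_smul, hi, smul_zero]
  left_rowFinite i := Subalgebra.smul_mem _ (f_mem_rowFinite _) _
  right_rowFinite i := Subalgebra.smul_mem _ (fDag_mem_rowFinite _) _

lemma isFermionPair_comb {m : ℤ → ℤ} (hm : IsLabelling m) (s : ℤ → ℂ) (a : ℂ) (c : ℤ → ℂ)
    (hc : ∀ i j, (a • (f i + c i • fDag (-i))) * (a • (f j + c j • fDag (-j))) +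
      (a • (f j + c j • fDag (-j))) * (a • (f i + c i • fDag (-i))) = bracket i j • 1) :
    IsFermionPair (fun i => a • (f (m i) + c (m i) • fDag (-m i)))
      (fun i => s i • a • (f (-m i) + c (-m i) • fDag (- -m i))) where
  anticomm i j hij := by
    have h := hc (m i) (-m j)
    rw [bracket, if_neg (by have := hm.injective.ne hij; omega), zero_smul] at h
    rw [mul_smul_comm (s j), smul_mul_assoc (s j), ← smul_add, h, smul_zero]
  left_vac i hi := by
    simp [f_vac (hm.neg i hi), fDag_vac (show 0 ≤ -m i by have := hm.neg i hi; omega)]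
  right_vac i hi := by
    have := hm.pos i hi
    simp [f_vac (show -m i < 0 by omega), fDag_vac (show 0 ≤ m i by omega)]
  left_atBot v := hm.tendsto_atBot.eventually (eventually_comb_apply a c v)
  right_atTop v := by
    filter_upwards [(tendsto_neg_atTop_atBot.comp hm.tendsto_atTop).eventually
      (eventually_comb_apply a c v)] with i hi
    rw [LinearMap.smul_apply]
    exact (congrArg (s i • ·) hi).trans (smul_zero _)
  left_atTop S := hm.tendsto_atTop.eventually (eventually_lapply_comp_comb a c S)
  right_atBot S := by
    filter_upwards [(tendsto_neg_atBot_atTop.comp hm.tendsto_atBot).eventually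
      (eventually_lapply_comp_comb a c S)] with i hi
    rw [LinearMap.comp_smul]
    exact (congrArg (s i • ·) hi).trans (smul_zero _)
  left_rowFinite i := Subalgebra.smul_mem _ (Subalgebra.add_mem _ (f_mem_rowFinite _)
    (Subalgebra.smul_mem _ (fDag_mem_rowFinite _) _)) _
  right_rowFinite i := Subalgebra.smul_mem _ (Subalgebra.smul_mem _
    (Subalgebra.add_mem _ (f_mem_rowFinite _)
    (Subalgebra.smul_mem _ (fDag_mem_rowFinite _) _)) _) _

lemma isFermionPair_psi1 : IsFermionPair psi1 psi1Dag := by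
  convert isFermionPair_f isLabelling_label1 (fun _ => 1) using 2 with i i <;>
    simp only [psi1, psi1Dag, label1] <;> split_ifs <;> simp

lemma isFermionPair_psi2 : IsFermionPair psi2 psi2Dag := by
  convert isFermionPair_f isLabelling_label2 (fun i => if 0 ≤ i then 1 else -1) using 2 with i i <;>
    simp only [psi2, psi2Dag, label2] <;> split_ifs <;> module

/-- The sign relating `ψ_j†` to a neutral fermion. -/
def dagSign (j : ℤ) : ℂ := if 0 ≤ j then -1 else 1

lemma neg_one_zpow_label1 (j : ℤ) : (-1 : ℂ) ^ label1 j = dagSign j := by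
  unfold label1 dagSign
  split_ifs
  · rw [zpow_add₀ (by norm_num), zpow_mul]; norm_num
  · rw [zpow_mul]; norm_num

lemma psi2Dag_neg (j : ℤ) : psi2Dag (-1 - j) = dagSign j • fDag (-label1 j) := by
  unfold psi2Dag label1 dagSign
  split_ifs with h1 h2 h2
  · omega
  · rw [one_smul]; congr 1; ring
  · rw [show 2 * (-1 - j) + 1 = -(2 * j + 1) by ring]; module
  · omega

lemma psi2_neg (j : ℤ) : psi2 (-1 - j) = dagSign j • f (-label1 j) := by
  unfold psi2 label1 dagSign
  split_ifs with h1 h2 h2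
  · omega
  · rw [one_smul]; congr 1; ring
  · rw [show 2 * (-1 - j) + 1 = -(2 * j + 1) by ring]; module
  · omega

lemma psi1_eq (j : ℤ) : psi1 j = f (label1 j) := by
  unfold psi1 label1; split_ifs <;> rfl

lemma psi1Dag_eq (j : ℤ) : psi1Dag j = fDag (label1 j) := by
  unfold psi1Dag label1; split_ifs <;> rfl

lemma dagSign_mul_self (j : ℤ) : dagSign j * dagSign j = 1 := by
  unfold dagSign; split_ifs <;> norm_num

/-- ψ^(1)_j carries the label m = `label1 j`, and ψ^(2)†_{-1-j} carries -m with the sign (-1)^m. The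
minus sign in the definition of ψ^(2) is what makes this match b_m exactly. -/
lemma psi_eq (j : ℤ) : psi j = b (label1 j) := by
  rw [psi, b, psi1_eq, psi2Dag_neg, neg_one_zpow_label1]

lemma psiDag_eq (j : ℤ) : psiDag j = dagSign j • b (-label1 j) := by
  rw [psiDag, b, psi1Dag_eq, psi2_neg, neg_one_zpow_neg, neg_one_zpow_label1, neg_neg,
    smul_comm (dagSign j), smul_add (dagSign j), smul_smul (dagSign j), dagSign_mul_self, one_smul,
    add_comm]

/-- The image of `ψ_j` under `b_j ↦ b̂_j`. -/
def psiHat (j : ℤ) : Op := bHat (label1 j)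

/-- The image of `ψ_j†` under `b_j ↦ b̂_j`. -/
def psiHatDag (j : ℤ) : Op := dagSign j • bHat (-label1 j)

/-- The image of `β_k` under `b_j ↦ b̂_j`. -/
def betaHat (k : ℤ) : Op := oscillator psiHat psiHatDag k

lemma psiHat_eq (j : ℤ) :
    psiHat j = (Complex.I * invSqrtTwo) • (psi1 j + (-1 : ℂ) • psi2Dag (-1 - j)) := by
  rw [psiHat, bHat_eq, psi1_eq, psi2Dag_neg, neg_one_zpow_label1]; module

lemma psiHatDag_eq (j : ℤ) :
    psiHatDag j = (-Complex.I * invSqrtTwo) • (psi1Dag j + (-1 : ℂ) • psi2 (-1 - j)) := by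
  rw [psiHatDag, bHat_eq, psi1Dag_eq, psi2_neg, neg_one_zpow_neg, neg_one_zpow_label1, neg_neg]
  unfold dagSign
  split_ifs <;> module

lemma isFermionPair_psi : IsFermionPair psi psiDag := by
  rw [funext psi_eq, funext psiDag_eq]
  exact isFermionPair_comb isLabelling_label1 dagSign invSqrtTwo (fun j => (-1 : ℂ) ^ j) b_anticomm

lemma isFermionPair_psiHat : IsFermionPair psiHat psiHatDag := by
  unfold psiHat psiHatDag
  rw [funext bHat_eq]
  refine isFermionPair_comb isLabelling_label1 dagSign (Complex.I * invSqrtTwo)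
    (fun j => -(-1 : ℂ) ^ j) ?_
  simpa only [bHat_eq] using bHat_anticomm

lemma psi_mem_hatPairs (j : ℤ) : (psi j, psiHat j) ∈ hatPairs 1 := by
  rw [psi_eq]; exact b_mem_hatPairs _

lemma psiDag_mem_hatPairs (j : ℤ) : (psiDag j, psiHatDag j) ∈ hatPairs 1 := by
  rw [psiDag_eq]; exact smul_mem_hatPairs _ (b_mem_hatPairs _)

lemma psi_mul_psiDag_mem_hatPairs (i j : ℤ) :
    (psi i * psiDag j, psiHat i * psiHatDag j) ∈ hatPairs 0 := by
  have := mul_mem_hatPairs (psi_mem_hatPairs i) (psiDag_mem_hatPairs j)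
  rwa [show (1 + 1 : ZMod 2) = 0 from rfl] at this

lemma commute_bHat_beta {k : ℤ} (hk : 0 < k) (j : ℤ) : Commute (bHat j) (beta k) :=
  isFermionPair_psi.commute_oscillator hk fun i =>
    commute_bHat_of_mem (psi_mul_psiDag_mem_hatPairs i (i + k)) j

lemma commute_b_betaHat {k : ℤ} (hk : 0 < k) (j : ℤ) : Commute (b j) (betaHat k) :=
  isFermionPair_psiHat.commute_oscillator hk fun i =>
    commute_b_of_mem (psi_mul_psiDag_mem_hatPairs i (i + k)) j

lemma commute_beta_betaHat {k l : ℤ} (hk : 0 < k) (hl : 0 < l) : Commute (beta k) (betaHat l) :=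
  isFermionPair_psiHat.commute_oscillator hl fun i =>
    (commute_snd_of_mem (psi_mul_psiDag_mem_hatPairs i (i + l))
      fun j => commute_bHat_beta hk j).symm

/-- The pairs of vectors `(X|0⟩, X̂|0⟩)` for even `X`. -/
def IsHatVec (v v' : Fock) : Prop := ∃ X X', (X, X') ∈ hatPairs 0 ∧ v = X vac ∧ v' = X' vac

/-- On given vectors β_k and β̂_k act through finitely many summands. A common finite index set for
both keeps the truncated sums a pair. -/
lemma IsHatVec.beta {k : ℤ} (hk : 0 < k) {v v' : Fock} (h : IsHatVec v v') :
    IsHatVec (beta k v) (betaHat k v') := by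
  obtain ⟨X, X', hX, rfl, rfl⟩ := h
  set K := (isFermionPair_psi.finite_support hk (X vac)).toFinset ∪
    (isFermionPair_psiHat.finite_support hk (X' vac)).toFinset with hK
  have h1 : (∑ i ∈ K, psi i * psiDag (i + k), ∑ i ∈ K, psiHat i * psiHatDag (i + k)) ∈
      hatPairs 0 := by
    have : (∑ i ∈ K, psi i * psiDag (i + k), ∑ i ∈ K, psiHat i * psiHatDag (i + k)) =
        ∑ i ∈ K, (psi i * psiDag (i + k), psiHat i * psiHatDag (i + k)) := by
      simp only [Prod.ext_iff, Prod.fst_sum, Prod.snd_sum, and_self]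
    rw [this]
    exact Submodule.sum_mem _ fun i _ => psi_mul_psiDag_mem_hatPairs i (i + k)
  have h2 := mul_mem_hatPairs h1 hX
  rw [add_zero] at h2
  exact ⟨_, _, h2, isFermionPair_psi.oscillator_apply_eq_sum hk _ Finset.subset_union_left,
    isFermionPair_psiHat.oscillator_apply_eq_sum hk _ Finset.subset_union_right⟩

/-- The hatted fermions differ by the relative sign of their two components, so the mixed terms
cancel in the sum. Reordering the surviving (2)-term gives the minus sign. -/
lemma psi_psiDag_add (i j : ℤ) (hij : i ≠ j) :
    psi i * psiDag j + psiHat i * psiHatDag j =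
      psi1 i * psi1Dag j + (-1 : ℂ) • (psi2 (-1 - j) * psi2Dag (-1 - i)) := by
  have h : (Complex.I * invSqrtTwo) * (-Complex.I * invSqrtTwo) = 1 / 2 := by
    linear_combination (-invSqrtTwo * invSqrtTwo) * Complex.I_mul_I + invSqrtTwo_mul_self
  rw [isFermionPair_psi2.mul_eq (by omega), psiHat_eq, psiHatDag_eq, psi, psiDag,
    smul_mul_smul_comm, smul_mul_smul_comm, h, invSqrtTwo_mul_self]
  simp only [smul_mul_assoc, mul_smul_comm, mul_add, add_mul]
  module

lemma beta_add_betaHat {k : ℤ} (hk : 0 < k) :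
    beta k + betaHat k = alpha1 k + (-1 : ℂ) • alpha2 k := by
  refine LinearMap.ext fun v => ?_
  have h2 : oscillator psi2 psi2Dag k v =
      ∑ᶠ i, (psi2 (-1 - (i + k)) * psi2Dag (-1 - i)) v := by
    rw [isFermionPair_psi2.oscillator_apply hk]
    -- The reflection i ↦ -1 - k - i turns the pairs of indices (-1 - (i + k), -1 - i) into (i, i +
    -- k).
    refine (finsum_comp_equiv (Equiv.subLeft (-1 - k))).symm.trans (finsum_congr fun i => ?_)
    rw [Equiv.subLeft_apply, show -1 - k - i + k = -1 - i by ring,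
      show -1 - k - i = -1 - (i + k) by ring]
  have hs : (Function.support fun i =>
      (psi2 (-1 - (i + k)) * psi2Dag (-1 - i)) v).Finite := by
    refine ((isFermionPair_psi2.finite_support hk v).preimage
      ((Equiv.subLeft (-1 - k)).injective.injOn)).subset fun i hi => ?_
    simp only [Set.mem_preimage, Function.mem_support, Equiv.subLeft_apply] at hi ⊢
    rwa [show -1 - k - i + k = -1 - i by ring, show -1 - k - i = -1 - (i + k) by ring]
  have hs' : (Function.support fun i =>
      (-1 : ℂ) • (psi2 (-1 - (i + k)) * psi2Dag (-1 - i)) v).Finite :=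
    hs.subset fun i hi h0 => hi ((congrArg ((-1 : ℂ) • ·) h0).trans (smul_zero _))
  simp only [LinearMap.add_apply, LinearMap.smul_apply, beta, betaHat, alpha1, alpha2]
  rw [h2, isFermionPair_psi.oscillator_apply hk, isFermionPair_psiHat.oscillator_apply hk,
    isFermionPair_psi1.oscillator_apply hk, smul_finsum, ← finsum_add_distrib
    (isFermionPair_psi.finite_support hk v) (isFermionPair_psiHat.finite_support hk v),
    ← finsum_add_distrib (isFermionPair_psi1.finite_support hk v) hs']
  refine finsum_congr fun i => ?_
  have := LinearMap.congr_fun (psi_psiDag_add i (i + k) (by omega)) v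
  simpa only [LinearMap.add_apply, LinearMap.smul_apply] using this

end Oscillators

/-! ### Formal exponentials with operator coefficients. -/

section Series

open Finset MvPowerSeries

section ExpSeries

variable {σ : Type}

lemma coeff_linearSeries_single (H : σ → Op) (k : σ) :
    coeff (Finsupp.single k 1) (linearSeries H) = H k := by
  classical
  change ∑ j ∈ (Finsupp.single k 1).support, _ = _
  rw [Finsupp.support_single k one_ne_zero, Finset.sum_singleton, if_pos rfl]

lemma coeff_linearSeries_eq_zero (H : σ → Op) {d : σ →₀ ℕ} (h : ∀ k, d ≠ Finsupp.single k 1) :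
    coeff d (linearSeries H) = 0 := by
  classical
  change ∑ k ∈ d.support, _ = _
  exact Finset.sum_eq_zero fun k _ => if_neg (h k)

lemma linearSeries_add (H G : σ → Op) :
    linearSeries (fun k => H k + G k) = linearSeries H + linearSeries G := by
  ext1 d
  rw [map_add]
  by_cases h : ∃ k, d = Finsupp.single k 1
  · obtain ⟨k, rfl⟩ := h
    simp only [coeff_linearSeries_single]
  · push Not at h
    simp only [coeff_linearSeries_eq_zero _ h, add_zero]

lemma coeff_linearSeries_pow_eq_zero (H : σ → Op) (N : ℕ) :
    ∀ d : σ →₀ ℕ, d.degree ≠ N → coeff d (linearSeries H ^ N) = 0 := by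
  classical
  induction N with
  | zero =>
    intro d hd
    rw [pow_zero, coeff_one, if_neg]
    rintro rfl; simp at hd
  | succ N ih =>
    intro d hd
    rw [pow_succ', coeff_mul]
    refine Finset.sum_eq_zero fun p hp => ?_
    rw [HasAntidiagonal.mem_antidiagonal] at hp
    by_cases h : ∃ k, p.1 = Finsupp.single k 1
    · obtain ⟨k, hk⟩ := h
      rw [ih p.2, mul_zero]
      intro h2
      rw [← hp, map_add, hk, Finsupp.degree_single, h2] at hd
      omega
    · push Not at h
      rw [coeff_linearSeries_eq_zero _ h, zero_mul]

/-- The N-th power of the linear series is homogeneous of degree N, so only N = |d| contributes. -/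
lemma coeff_expSeries (H : σ → Op) (d : σ →₀ ℕ) :
    coeff d (expSeries H) =
      ((d.degree.factorial : ℂ)⁻¹) • coeff d (linearSeries H ^ d.degree) := by
  change ∑ N ∈ range (d.degree + 1), _ = _
  refine Finset.sum_eq_single _ (fun N _ hN => ?_) (fun h => absurd (by simp) h)
  rw [coeff_linearSeries_pow_eq_zero H N d (Ne.symm hN), smul_zero]

lemma coeff_expSeries_induction {P : Op → Op → Prop} (H G : σ → Op) (zero : P 0 0) (one : P 1 1)
    (add : ∀ X X' Y Y', P X X' → P Y Y' → P (X + Y) (X' + Y'))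
    (smul : ∀ (c : ℂ) X X', P X X' → P (c • X) (c • X'))
    (mul : ∀ k X X', P X X' → P (H k * X) (G k * X')) (d : σ →₀ ℕ) :
    P (coeff d (expSeries H)) (coeff d (expSeries G)) := by
  classical
  rw [coeff_expSeries, coeff_expSeries]
  apply smul
  generalize d.degree = N
  induction N generalizing d with
  | zero =>
    rw [pow_zero, pow_zero, coeff_one]
    split_ifs
    exacts [one, zero]
  | succ N ih =>
    rw [pow_succ', pow_succ', coeff_mul, coeff_mul]
    induction antidiagonal d using Finset.induction_on with
    | empty => exact zero
    | insert p s hp hs =>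
      rw [Finset.sum_insert hp, Finset.sum_insert hp]
      refine add _ _ _ _ ?_ hs
      by_cases h : ∃ k, p.1 = Finsupp.single k 1
      · obtain ⟨k, hk⟩ := h
        rw [hk, coeff_linearSeries_single, coeff_linearSeries_single]
        exact mul _ _ _ (ih _)
      · push Not at h
        rw [coeff_linearSeries_eq_zero _ h, coeff_linearSeries_eq_zero _ h, zero_mul, zero_mul]
        exact zero

lemma commute_coeff_linearSeries {H G : σ → Op} (hc : ∀ k l, Commute (H k) (G l))
    (d e : σ →₀ ℕ) : Commute (coeff d (linearSeries H)) (coeff e (linearSeries G)) := by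
  by_cases h : ∃ k, d = Finsupp.single k 1
  · by_cases h' : ∃ k, e = Finsupp.single k 1
    · obtain ⟨k, rfl⟩ := h
      obtain ⟨l, rfl⟩ := h'
      rw [coeff_linearSeries_single, coeff_linearSeries_single]
      exact hc k l
    · push Not at h'
      rw [coeff_linearSeries_eq_zero _ h']
      exact Commute.zero_right _
  · push Not at h
    rw [coeff_linearSeries_eq_zero _ h]
    exact Commute.zero_left _

lemma commute_linearSeries {H G : σ → Op} (hc : ∀ k l, Commute (H k) (G l)) :
    Commute (linearSeries H) (linearSeries G) := by
  classical
  refine MvPowerSeries.ext fun d => ?_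
  rw [coeff_mul, coeff_mul]
  refine Eq.trans (Finset.sum_congr rfl fun p _ => (commute_coeff_linearSeries hc _ _).eq)
    (Finsupp.sum_antidiagonal_swap d fun a e =>
      coeff e (linearSeries G) * coeff a (linearSeries H))

/-- This is exp(H + G) = exp(H) exp(G) for commuting exponents, by the binomial theorem. -/
lemma coeff_expSeries_add [DecidableEq σ] {H G : σ → Op} (hc : ∀ k l, Commute (H k) (G l))
    (d : σ →₀ ℕ) :
    coeff d (expSeries fun k => H k + G k) =
      ∑ p ∈ antidiagonal d, coeff p.1 (expSeries H) * coeff p.2 (expSeries G) := by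
  rw [coeff_expSeries, linearSeries_add, (commute_linearSeries hc).add_pow', map_sum]
  simp only [map_nsmul, coeff_mul, Finset.smul_sum]
  rw [Finset.sum_comm]
  refine Finset.sum_congr rfl fun p hp => ?_
  rw [HasAntidiagonal.mem_antidiagonal] at hp
  have hdeg : p.1.degree + p.2.degree = d.degree := by rw [← hp, map_add]
  -- By homogeneity only the binomial term whose exponents are the degrees of the two monomials
  -- survives.
  rw [Finset.sum_eq_single (p.1.degree, p.2.degree)]
  · rw [coeff_expSeries, coeff_expSeries, smul_mul_smul_comm, ← Nat.cast_smul_eq_nsmul ℂ, smul_smul,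
      ← hdeg, Nat.cast_add_choose]
    congr 1
    have h1 : ((p.1.degree + p.2.degree).factorial : ℂ) ≠ 0 := by
      exact_mod_cast Nat.factorial_ne_zero _
    field_simp
  · rintro ⟨m, n⟩ hm hne
    rw [HasAntidiagonal.mem_antidiagonal] at hm
    have : p.1.degree ≠ m := by
      rintro rfl
      apply hne
      ext
      · rfl
      · simp only at hm ⊢; omega
    rw [coeff_linearSeries_pow_eq_zero H m _ this, zero_mul, smul_zero, smul_zero]
  · intro h
    exact absurd (HasAntidiagonal.mem_antidiagonal.2 hdeg) h

/-- The monomials in two sets of variables which become `s^d` if both are replaced by `s`. -/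
def doubleFiber [DecidableEq σ] (d : σ →₀ ℕ) : Finset (σ ⊕ σ →₀ ℕ) :=
  (antidiagonal d).map (Finsupp.sumFinsuppAddEquivProdFinsupp (M := ℕ)).symm.toEmbedding

/-- The exponents after identifying the two sets of variables. -/
def mergeExp : (σ ⊕ σ →₀ ℕ) →+ (σ →₀ ℕ) :=
  (AddMonoidHom.coprod (AddMonoidHom.id _) (AddMonoidHom.id _)).comp
    (Finsupp.sumFinsuppAddEquivProdFinsupp (M := ℕ)).toAddMonoidHom

lemma mergeExp_apply (e : σ ⊕ σ →₀ ℕ) : mergeExp e =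
    (Finsupp.sumFinsuppAddEquivProdFinsupp e).1 + (Finsupp.sumFinsuppAddEquivProdFinsupp e).2 :=
  rfl

/-- The sign produced by changing the sign of the second set of variables. -/
def mergeSign (e : σ ⊕ σ →₀ ℕ) : ℂ :=
  (-1 : ℂ) ^ (Finsupp.sumFinsuppAddEquivProdFinsupp e).2.degree

lemma mem_doubleFiber [DecidableEq σ] {d : σ →₀ ℕ} {e : σ ⊕ σ →₀ ℕ} : e ∈ doubleFiber d ↔ mergeExp e = d := by
  rw [doubleFiber, Finset.mem_map, mergeExp_apply]
  constructor
  · rintro ⟨p, hp, rfl⟩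
    simpa using hp
  · intro h
    exact ⟨_, HasAntidiagonal.mem_antidiagonal.2 h, by simp⟩

lemma mergeSign_add (e e' : σ ⊕ σ →₀ ℕ) : mergeSign (e + e') = mergeSign e * mergeSign e' := by
  rw [mergeSign, map_add, Prod.snd_add, map_add, pow_add, mergeSign, mergeSign]

lemma mergeSign_zero : mergeSign (0 : σ ⊕ σ →₀ ℕ) = 1 := by simp [mergeSign]

lemma splitExp_single_inl (k : σ) (n : ℕ) :
    Finsupp.sumFinsuppAddEquivProdFinsupp (Finsupp.single (Sum.inl k : σ ⊕ σ) n) =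
      (Finsupp.single k n, 0) := by
  classical
  refine Prod.ext (Finsupp.ext fun x => ?_) (Finsupp.ext fun x => ?_) <;>
    simp [Finsupp.single_apply]

lemma splitExp_single_inr (k : σ) (n : ℕ) :
    Finsupp.sumFinsuppAddEquivProdFinsupp (Finsupp.single (Sum.inr k : σ ⊕ σ) n) =
      (0, Finsupp.single k n) := by
  classical
  refine Prod.ext (Finsupp.ext fun x => ?_) (Finsupp.ext fun x => ?_) <;>
    simp [Finsupp.single_apply]

lemma degree_mergeExp (e : σ ⊕ σ →₀ ℕ) : (mergeExp e).degree = e.degree := by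
  induction e using Finsupp.induction_linear with
  | zero => simp
  | add e e' h h' => simp only [map_add, h, h']
  | single x n =>
    rw [mergeExp_apply]
    cases x <;> simp

/-- The substitution `t^(1) = s`, `t^(2) = -s` for series with operator coefficients. -/
def mergeSeries [DecidableEq σ] (B : MvPowerSeries (σ ⊕ σ) Op) : MvPowerSeries σ Op := fun d =>
  ∑ e ∈ doubleFiber d, mergeSign e • coeff e B

lemma coeff_mergeSeries [DecidableEq σ] (B : MvPowerSeries (σ ⊕ σ) Op) (d : σ →₀ ℕ) :
    coeff d (mergeSeries B) = ∑ e ∈ doubleFiber d, mergeSign e • coeff e B := rfl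

/-- The variables commute with the operator coefficients, so the substitution is multiplicative. On
powers of the exponent it is then determined by its effect on the linear series. -/
lemma mergeSeries_mul [DecidableEq σ] (B C : MvPowerSeries (σ ⊕ σ) Op) :
    mergeSeries (B * C) = mergeSeries B * mergeSeries C := by
  ext1 d
  simp only [coeff_mergeSeries, coeff_mul, Finset.sum_mul_sum, Finset.smul_sum]
  simp only [← Finset.sum_product']
  rw [Finset.sum_sigma', Finset.sum_sigma']
  refine Finset.sum_bij' (fun x _ => ⟨(mergeExp x.2.1, mergeExp x.2.2), x.2⟩)
    (fun x _ => ⟨x.2.1 + x.2.2, x.2⟩) ?_ ?_ ?_ ?_ ?_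
  · rintro ⟨e, p⟩ h
    simp only [mem_sigma, mem_doubleFiber, HasAntidiagonal.mem_antidiagonal, mem_product] at h ⊢
    refine ⟨?_, trivial, trivial⟩
    rw [← map_add, h.2, h.1]
  · rintro ⟨e, p⟩ h
    simp only [mem_sigma, mem_doubleFiber, HasAntidiagonal.mem_antidiagonal, mem_product] at h ⊢
    refine ⟨?_, trivial⟩
    rw [map_add, h.2.1, h.2.2, h.1]
  · rintro ⟨e, p⟩ h
    simp only [mem_sigma, mem_doubleFiber, HasAntidiagonal.mem_antidiagonal] at h
    simp [h.2]
  · rintro ⟨e, p⟩ h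
    simp only [mem_sigma, mem_doubleFiber, HasAntidiagonal.mem_antidiagonal, mem_product] at h
    simp [h.2]
  · rintro ⟨e, p⟩ h
    simp only [mem_sigma, mem_doubleFiber, HasAntidiagonal.mem_antidiagonal] at h
    rw [← h.2, mergeSign_add, smul_mul_smul_comm]

lemma mergeSeries_one [DecidableEq σ] : mergeSeries (1 : MvPowerSeries (σ ⊕ σ) Op) = 1 := by
  ext1 d
  simp only [coeff_mergeSeries, coeff_one]
  by_cases hd : d = 0
  · subst hd
    rw [if_pos rfl, Finset.sum_eq_single 0]
    · rw [if_pos rfl, mergeSign_zero, one_smul]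
    · intro e _ he; rw [if_neg he, smul_zero]
    · intro h; exact absurd (mem_doubleFiber.2 (map_zero _)) h
  · rw [if_neg hd]
    refine Finset.sum_eq_zero fun e he => ?_
    rw [if_neg, smul_zero]
    rintro rfl
    rw [mem_doubleFiber, map_zero] at he
    exact hd he.symm

lemma mergeSeries_pow [DecidableEq σ] (B : MvPowerSeries (σ ⊕ σ) Op) (N : ℕ) :
    mergeSeries (B ^ N) = mergeSeries B ^ N := by
  induction N with
  | zero => rw [pow_zero, pow_zero, mergeSeries_one]
  | succ N ih => rw [pow_succ, pow_succ, mergeSeries_mul, ih]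

lemma mergeSeries_linearSeries [DecidableEq σ] (H G : σ → Op) :
    mergeSeries (linearSeries (Sum.elim H G)) = linearSeries fun k => H k + (-1 : ℂ) • G k := by
  ext1 d
  rw [coeff_mergeSeries]
  have hinl (k : σ) : mergeExp (Finsupp.single (Sum.inl k) 1) = Finsupp.single k 1 := by
    rw [mergeExp_apply, splitExp_single_inl, add_zero]
  have hinr (k : σ) : mergeExp (Finsupp.single (Sum.inr k) 1) = Finsupp.single k 1 := by
    rw [mergeExp_apply, splitExp_single_inr, zero_add]
  by_cases h : ∃ k, d = Finsupp.single k 1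
  · obtain ⟨k, rfl⟩ := h
    have hne : (Finsupp.single (Sum.inl k) 1 : σ ⊕ σ →₀ ℕ) ≠ Finsupp.single (Sum.inr k) 1 := by
      intro h; simp [Finsupp.single_left_inj one_ne_zero] at h
    rw [coeff_linearSeries_single, ← Finset.sum_subset (s₁ := {Finsupp.single (Sum.inl k) 1,
      Finsupp.single (Sum.inr k) 1}), Finset.sum_pair hne, coeff_linearSeries_single,
      coeff_linearSeries_single]
    · simp [mergeSign]
    · intro e he
      rw [mem_doubleFiber]
      rcases Finset.mem_insert.1 he with rfl | he
      · exact hinl k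
      · rw [Finset.mem_singleton.1 he]; exact hinr k
    · intro e he he'
      rw [coeff_linearSeries_eq_zero, smul_zero]
      rintro (l | l) rfl <;> rw [mem_doubleFiber] at he
      · rw [hinl, Finsupp.single_left_inj one_ne_zero] at he
        subst he; simp at he'
      · rw [hinr, Finsupp.single_left_inj one_ne_zero] at he
        subst he; simp at he'
  · push Not at h
    rw [coeff_linearSeries_eq_zero _ h]
    refine Finset.sum_eq_zero fun e he => ?_
    rw [coeff_linearSeries_eq_zero, smul_zero]
    rintro (l | l) rfl <;> rw [mem_doubleFiber] at he
    · exact h l (he.symm.trans (hinl l))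
    · exact h l (he.symm.trans (hinr l))

/-- Identifying variables preserves the total degree, so all terms of the fibre share the factor
1/|d|!. -/
lemma sum_doubleFiber_coeff_expSeries [DecidableEq σ] (H G : σ → Op) (d : σ →₀ ℕ) :
    ∑ e ∈ doubleFiber d, mergeSign e • coeff e (expSeries (Sum.elim H G)) =
      coeff d (expSeries fun k => H k + (-1 : ℂ) • G k) := by
  rw [coeff_expSeries, ← mergeSeries_linearSeries, ← mergeSeries_pow, coeff_mergeSeries,
    Finset.smul_sum]
  refine Finset.sum_congr rfl fun e he => ?_
  rw [mem_doubleFiber] at he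
  rw [coeff_expSeries, ← degree_mergeExp e, he, smul_comm]

end ExpSeries

/-! ### The substitution t^(1) = s, t^(2) = -s in scalar power series. -/

lemma coeff_plusMinus (x : ℕ+ ⊕ ℕ+) : plusMinus x =
    MvPowerSeries.monomial (mergeExp (Finsupp.single x 1)) (mergeSign (Finsupp.single x 1)) := by
  rw [mergeExp_apply, mergeSign]
  rcases x with k | k
  · simp [plusMinus, MvPowerSeries.X]
  · simp [plusMinus, MvPowerSeries.X]

lemma prod_plusMinus (e : ℕ+ ⊕ ℕ+ →₀ ℕ) :
    (e.prod fun x n => plusMinus x ^ n) = MvPowerSeries.monomial (mergeExp e) (mergeSign e) := by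
  induction e using Finsupp.induction_linear with
  | zero => simp [mergeSign_zero]
  | add e e' h h' =>
    rw [Finsupp.prod_add_index' (by simp) (fun x m n => pow_add _ _ _), h, h', map_add,
      mergeSign_add, MvPowerSeries.monomial_mul_monomial]
  | single x n =>
    rw [Finsupp.prod_single_index (h := fun x n => plusMinus x ^ n) (pow_zero _), coeff_plusMinus, MvPowerSeries.monomial_pow,
      ← map_nsmul, Finsupp.smul_single, smul_eq_mul, mul_one]
    congr 1
    induction n with
    | zero => simp [mergeSign_zero]
    | succ n ih => rw [pow_succ, ih, Finsupp.single_add, mergeSign_add]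

lemma hasSubst_plusMinus : MvPowerSeries.HasSubst plusMinus where
  const_coeff x := by
    rcases x with k | k <;> simp [plusMinus]
  coeff_zero d := by
    by_cases h : ∃ k, d = Finsupp.single k 1
    · obtain ⟨k, rfl⟩ := h
      refine (Set.toFinite {Sum.inl k, Sum.inr k}).subset fun x hx => ?_
      rcases x with l | l <;> simp [plusMinus, MvPowerSeries.coeff_X] at hx ⊢
      · rw [Finsupp.single_left_inj one_ne_zero] at hx; exact hx.symm
      · rw [Finsupp.single_left_inj one_ne_zero] at hx; exact hx.symm
    · push Not at h
      refine Set.finite_empty.subset fun x hx => ?_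
      rcases x with l | l <;> simp [plusMinus, MvPowerSeries.coeff_X, h] at hx

lemma coeff_subst_plusMinus (F : MvPowerSeries (ℕ+ ⊕ ℕ+) ℂ) (d : ℕ+ →₀ ℕ) :
    MvPowerSeries.coeff d (MvPowerSeries.subst plusMinus F) =
      ∑ e ∈ doubleFiber d, mergeSign e * MvPowerSeries.coeff e F := by
  rw [MvPowerSeries.coeff_subst hasSubst_plusMinus]
  simp only [prod_plusMinus, MvPowerSeries.coeff_monomial]
  rw [finsum_eq_sum_of_support_subset (s := doubleFiber d)]
  · refine Finset.sum_congr rfl fun e he => ?_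
    rw [mem_doubleFiber] at he
    rw [if_pos he.symm, smul_eq_mul, mul_comm]
  · intro e he
    rw [Finset.mem_coe, mem_doubleFiber]
    by_contra h
    exact he (by simp [Ne.symm h])

end Series

/-! ### The products Ψ†_n and comparison of the tau functions. -/

section TauFunctions

open MvPowerSeries

/-- The product of the first `N` operators of a sequence. -/
def rangeProd (y : ℕ → Op) (N : ℕ) : Op := ((List.range N).map y).prod

lemma rangeProd_zero (y : ℕ → Op) : rangeProd y 0 = 1 := by simp [rangeProd]

lemma rangeProd_succ (y : ℕ → Op) (N : ℕ) : rangeProd y (N + 1) = rangeProd y N * y N := by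
  simp [rangeProd, List.range_succ]

lemma mul_rangeProd {x : Op} {y : ℕ → Op} {N : ℕ}
    (h : ∀ k < N, x * y k = (-1 : ℂ) • (y k * x)) :
    x * rangeProd y N = (-1 : ℂ) ^ N • (rangeProd y N * x) := by
  induction N with
  | zero => simp [rangeProd_zero]
  | succ N ih =>
    rw [rangeProd_succ, ← mul_assoc, ih fun k hk => h k (by omega), smul_mul_assoc, mul_assoc,
      h N (by omega), mul_smul_comm, smul_smul, pow_succ, mul_assoc]

/-- Interleaving the two products costs the same sign on both sides, so only the factors c remain.
-/
lemma rangeProd_mul_rangeProd {y y' p q : ℕ → Op} {c : ℂ}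
    (h : ∀ k, y k * y' k = c • (p k * q k))
    (hy : ∀ j k, y j * y' k = (-1 : ℂ) • (y' k * y j))
    (hp : ∀ j k, p j * q k = (-1 : ℂ) • (q k * p j)) (N : ℕ) :
    rangeProd y N * rangeProd y' N = c ^ N • (rangeProd p N * rangeProd q N) := by
  induction N with
  | zero => simp [rangeProd_zero]
  | succ N ih =>
    have h1 := mul_rangeProd (x := y N) (y := y') (N := N) fun k _ => hy N k
    have h2 := mul_rangeProd (x := p N) (y := q) (N := N) fun k _ => hp N k
    have h3 : rangeProd y (N + 1) * rangeProd y' (N + 1) =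
        (-1 : ℂ) ^ N • ((rangeProd y N * rangeProd y' N) * (y N * y' N)) := by
      rw [rangeProd_succ, rangeProd_succ, mul_assoc, ← mul_assoc (y N), h1, smul_mul_assoc,
        mul_smul_comm]
      simp only [mul_assoc]
    have h4 : rangeProd p (N + 1) * rangeProd q (N + 1) =
        (-1 : ℂ) ^ N • ((rangeProd p N * rangeProd q N) * (p N * q N)) := by
      rw [rangeProd_succ, rangeProd_succ, mul_assoc, ← mul_assoc (p N), h2, smul_mul_assoc,
        mul_smul_comm]
      simp only [mul_assoc]
    rw [h3, h4, ih, h, smul_mul_smul_comm, smul_comm, pow_succ]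

lemma PsiDag_of_nonneg (x y : ℤ → Op) {n : ℤ} (hn : 0 ≤ n) :
    PsiDag x y n = rangeProd (fun k => y k) n.natAbs := by
  rw [PsiDag, if_pos hn, rangeProd, show n.toNat = n.natAbs by omega]
  simp [← List.map_eq_flatMap, Function.comp_def]

lemma PsiDag_of_nonpos (x y : ℤ → Op) {n : ℤ} (hn : n ≤ 0) :
    PsiDag x y n = rangeProd (fun k => x (-1 - (k : ℤ))) n.natAbs := by
  rcases hn.lt_or_eq with hn | rfl
  · rw [PsiDag, if_neg hn.not_ge, rangeProd]
    simp [← List.map_eq_flatMap, Function.comp_def]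
  · simp [PsiDag, rangeProd]

lemma PsiDag_mem_hatPairs (n : ℤ) :
    (PsiDag psi psiDag n, PsiDag psiHat psiHatDag n) ∈ hatPairs (n.natAbs : ZMod 2) := by
  rcases le_total 0 n with hn | hn
  · rw [PsiDag_of_nonneg _ _ hn, PsiDag_of_nonneg _ _ hn]
    have := list_prod_mem_hatPairs (fun k : ℕ => psiDag k) (fun k : ℕ => psiHatDag k) 1
      (fun k => psiDag_mem_hatPairs k) (List.range n.natAbs)
    rwa [List.length_range, mul_one] at this
  · rw [PsiDag_of_nonpos _ _ hn, PsiDag_of_nonpos _ _ hn]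
    have := list_prod_mem_hatPairs (fun k : ℕ => psi (-1 - k)) (fun k : ℕ => psiHat (-1 - k)) 1
      (fun k => psi_mem_hatPairs _) (List.range n.natAbs)
    rwa [List.length_range, mul_one] at this

lemma psi_psiHat_anticomm (j k : ℤ) : psi j * psiHat k = (-1 : ℂ) • (psiHat k * psi j) := by
  rw [psi_eq, psiHat, bHat_b_anticomm]; module

lemma psiDag_psiHatDag_anticomm (j k : ℤ) :
    psiDag j * psiHatDag k = (-1 : ℂ) • (psiHatDag k * psiDag j) := by
  rw [psiDag_eq, psiHatDag, smul_mul_smul_comm, smul_mul_smul_comm, bHat_b_anticomm]; module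

lemma label1_add_ne_zero (j k : ℤ) : label1 j + label1 k ≠ 0 := by
  unfold label1; split_ifs <;> omega

lemma psi1_psi2Dag_anticomm (j k : ℤ) :
    psi1 j * psi2Dag (-1 - k) = (-1 : ℂ) • (psi2Dag (-1 - k) * psi1 j) := by
  have h := f_fDag_anticomm (label1 j) (-label1 k)
  rw [if_neg (by have := label1_add_ne_zero j k; omega)] at h
  rw [psi1_eq, psi2Dag_neg, mul_smul_comm, op_eq_neg_of_add_eq_zero h, smul_mul_assoc]
  module

lemma psi1Dag_psi2_anticomm (j k : ℤ) :
    psi1Dag j * psi2 (-1 - k) = (-1 : ℂ) • (psi2 (-1 - k) * psi1Dag j) := by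
  have h := f_fDag_anticomm (-label1 k) (label1 j)
  rw [if_neg (by have := label1_add_ne_zero j k; omega), add_comm] at h
  rw [psi1Dag_eq, psi2_neg, mul_smul_comm, op_eq_neg_of_add_eq_zero h, smul_mul_assoc]
  module

lemma f_mul_self (i : ℤ) : f i * f i = 0 := by
  have := f_anticomm i i
  rw [← two_smul ℂ] at this
  exact (smul_eq_zero.1 this).resolve_left two_ne_zero

lemma fDag_mul_self (i : ℤ) : fDag i * fDag i = 0 := by
  have := fDag_anticomm i i
  rw [← two_smul ℂ] at this
  exact (smul_eq_zero.1 this).resolve_left two_ne_zero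

/-- In (X + Y)(X - Y) the squares vanish and the mixed terms -XY + YX add up to -2XY. -/
lemma comb_mul_comb {X Y : Op} (hX : X * X = 0) (hY : Y * Y = 0)
    (hXY : X * Y = (-1 : ℂ) • (Y * X)) (a c : ℂ) :
    (a • (X + Y)) * (c • (X + (-1 : ℂ) • Y)) = (-2 * (a * c)) • (X * Y) := by
  have h : Y * X = (-1 : ℂ) • (X * Y) := by rw [hXY]; module
  rw [smul_mul_smul_comm]
  simp only [mul_add, add_mul, mul_smul_comm, hX, hY, h]
  module

lemma psi_mul_psiHat (j : ℤ) : psi j * psiHat j = (-Complex.I) • (psi1 j * psi2Dag (-1 - j)) := by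
  rw [psi, psiHat_eq, comb_mul_comb _ _ (psi1_psi2Dag_anticomm j j)]
  · congr 1
    linear_combination (-2 * Complex.I) * invSqrtTwo_mul_self
  · rw [psi1_eq, f_mul_self]
  · rw [psi2Dag_neg, smul_mul_smul_comm, fDag_mul_self, smul_zero]

lemma psiDag_mul_psiHatDag (j : ℤ) :
    psiDag j * psiHatDag j = Complex.I • (psi1Dag j * psi2 (-1 - j)) := by
  rw [psiDag, psiHatDag_eq, comb_mul_comb _ _ (psi1Dag_psi2_anticomm j j)]
  · congr 1
    linear_combination (2 * Complex.I) * invSqrtTwo_mul_self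
  · rw [psi1Dag_eq, fDag_mul_self]
  · rw [psi2_neg, smul_mul_smul_comm, f_mul_self, smul_zero]

lemma PsiDag_mul_PsiDag (n : ℤ) : PsiDag psi psiDag n * PsiDag psiHat psiHatDag n =
    Complex.I ^ n • (PsiDag psi1 psi1Dag n * PsiDag psi2 psi2Dag (-n)) := by
  rcases le_total 0 n with hn | hn
  · rw [PsiDag_of_nonneg _ _ hn, PsiDag_of_nonneg _ _ hn, PsiDag_of_nonneg _ _ hn,
      PsiDag_of_nonpos _ _ (neg_nonpos.2 hn), Int.natAbs_neg,
      rangeProd_mul_rangeProd (fun k => psiDag_mul_psiHatDag k)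
        (fun j k => psiDag_psiHatDag_anticomm j k) (fun j k => psi1Dag_psi2_anticomm j k),
      ← zpow_natCast, Int.natAbs_of_nonneg hn]
  · have h (k : ℕ) : psi (-1 - (k : ℤ)) * psiHat (-1 - (k : ℤ)) =
        (-Complex.I) • (psi1 (-1 - (k : ℤ)) * psi2Dag k) := by
      rw [psi_mul_psiHat, sub_sub_cancel]
    have h' (j k : ℕ) : psi1 (-1 - (j : ℤ)) * psi2Dag k =
        (-1 : ℂ) • (psi2Dag k * psi1 (-1 - (j : ℤ))) := by
      have := psi1_psi2Dag_anticomm (-1 - (j : ℤ)) (-1 - (k : ℤ))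
      rwa [sub_sub_cancel] at this
    -- Here -i = i⁻¹ and n ≤ 0, so (-i)^{|n|} = i^n.
    rw [PsiDag_of_nonpos _ _ hn, PsiDag_of_nonpos _ _ hn, PsiDag_of_nonpos _ _ hn,
      PsiDag_of_nonneg _ _ (neg_nonneg.2 hn), Int.natAbs_neg,
      rangeProd_mul_rangeProd h (fun j k => psi_psiHat_anticomm _ _) h',
      ← Complex.inv_I, inv_pow, ← zpow_natCast, ← zpow_neg]
    congr 2
    omega

lemma vacBra_PsiDag_mul_PsiDag (n : ℤ) (X : Op) :
    vev (PsiDag psi psiDag n * PsiDag psiHat psiHatDag n * X) =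
      Complex.I ^ n * bra2 n (-n) (X vac) := by
  rw [PsiDag_mul_PsiDag, smul_mul_assoc, vev_smul]
  rfl

lemma phi_eq : phi = b 0 := by simp [phi, b]

/-- The coefficients of `exp (∑ s_k β_k)`. -/
def expBeta (d : ℕ+ →₀ ℕ) : Op := coeff d (expSeries fun k : ℕ+ => beta ((k : ℕ) : ℤ))

/-- The coefficients of `exp (∑ s_k β̂_k)`. -/
def expBetaHat (d : ℕ+ →₀ ℕ) : Op := coeff d (expSeries fun k : ℕ+ => betaHat ((k : ℕ) : ℤ))

lemma PNat.intCast_pos (k : ℕ+) : (0 : ℤ) < ((k : ℕ) : ℤ) := by exact_mod_cast k.pos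

lemma coeff_expSeries_mem {σ : Type} {H : σ → Op} {B : Subalgebra ℂ Op} (h : ∀ k, H k ∈ B)
    (d : σ →₀ ℕ) : coeff d (expSeries H) ∈ B :=
  coeff_expSeries_induction (P := fun X _ => X ∈ B) H H (Subalgebra.zero_mem _)
    (Subalgebra.one_mem _) (fun _ _ _ _ h1 h2 => Subalgebra.add_mem _ h1 h2)
    (fun c _ _ h => Subalgebra.smul_mem _ h c) (fun k _ _ hX => Subalgebra.mul_mem _ (h k) hX) d

lemma commute_coeff_expSeries {σ : Type} {H : σ → Op} {Y : Op} (h : ∀ k, Commute Y (H k))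
    (d : σ →₀ ℕ) : Commute Y (coeff d (expSeries H)) :=
  coeff_expSeries_induction (P := fun X _ => Commute Y X) H H (Commute.zero_right _)
    (Commute.one_right _) (fun _ _ _ _ h1 h2 => h1.add_right h2)
    (fun c _ _ h => h.smul_right c) (fun k _ _ hX => (h k).mul_right hX) d

lemma IsHatVec.expBeta {v v' : Fock} (h : IsHatVec v v') (d : ℕ+ →₀ ℕ) :
    IsHatVec (expBeta d v) (expBetaHat d v') := by
  refine coeff_expSeries_induction (P := fun X X' => IsHatVec (X v) (X' v')) _ _ ?_ h ?_ ?_ ?_ d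
  · exact ⟨0, 0, Submodule.zero_mem _, rfl, rfl⟩
  · rintro X X' Y Y' ⟨Z, Z', hZ, h1, h2⟩ ⟨W, W', hW, h3, h4⟩
    refine ⟨_, _, add_mem_hatPairs hZ hW, ?_, ?_⟩
    · rw [LinearMap.add_apply, h1, h3, LinearMap.add_apply]
    · rw [LinearMap.add_apply, h2, h4, LinearMap.add_apply]
  · rintro c X X' ⟨Z, Z', hZ, h1, h2⟩
    refine ⟨_, _, smul_mem_hatPairs c hZ, ?_, ?_⟩
    · rw [LinearMap.smul_apply, h1, LinearMap.smul_apply]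
    · rw [LinearMap.smul_apply, h2, LinearMap.smul_apply]
  · intro k X X' hX
    exact hX.beta (PNat.intCast_pos k)

lemma I_zpow_even {n : ℤ} (hn : Even n) :
    Complex.I ^ n = (-1 : ℂ) ^ (n * (n - 1) / 2) := by
  obtain ⟨m, rfl⟩ := hn
  rw [show (m + m) * (m + m - 1) / 2 = m * (2 * m - 1) by
    rw [show (m + m) * (m + m - 1) = 2 * (m * (2 * m - 1)) by ring]; simp,
    ← two_mul, zpow_mul, mul_comm m, zpow_mul, (show Odd (2 * m - 1) from ⟨m - 1, by ring⟩).neg_one_zpow]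
  norm_num

lemma I_zpow_odd {n : ℤ} (hn : Odd n) :
    -Complex.I * Complex.I ^ n = (-1 : ℂ) ^ (n * (n - 1) / 2) := by
  obtain ⟨m, rfl⟩ := hn
  rw [show (2 * m + 1) * (2 * m + 1 - 1) / 2 = (2 * m + 1) * m by
    rw [show (2 * m + 1) * (2 * m + 1 - 1) = 2 * ((2 * m + 1) * m) by ring]; simp,
    zpow_mul, (show Odd (2 * m + 1) from ⟨m, rfl⟩).neg_one_zpow, zpow_add₀ Complex.I_ne_zero,
    zpow_mul, zpow_one, show Complex.I ^ (2 : ℤ) = -1 by norm_num]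
  linear_combination (-(-1 : ℂ) ^ m) * Complex.I_mul_I

/-- The product of two coefficients of the large BKP tau function is a coefficient of the
two-component tau function. -/
theorem braB_mul_braB {T T' U U' : Op} (hT : (T, T') ∈ hatPairs 0) (hU : (U, U') ∈ hatPairs 0)
    (n : ℤ) (d e : ℕ+ →₀ ℕ) :
    braB n ((expBeta d * T) vac) * braB n ((expBeta e * U) vac) =
      (-1 : ℂ) ^ (n * (n - 1) / 2) *
        bra2 n (-n) ((expBeta d * expBetaHat e * (T * U')) vac) := by
  obtain ⟨T₁, T₂, hT₁, hTv, -⟩ := (show IsHatVec (T vac) (T' vac) from ⟨T, T', hT, rfl, rfl⟩).expBeta d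
  obtain ⟨U₁, U₂, hU₁, hUv, hUv'⟩ :=
    (show IsHatVec (U vac) (U' vac) from ⟨U, U', hU, rfl, rfl⟩).expBeta e
  have hC (j : ℤ) : Commute (bHat j) (expBeta d) :=
    commute_coeff_expSeries (fun k => commute_bHat_beta (PNat.intCast_pos k) j) d
  have hD (j : ℤ) : Commute (b j) (expBetaHat e) :=
    commute_coeff_expSeries (fun k => commute_b_betaHat (PNat.intCast_pos k) j) e
  have hP := PsiDag_mem_hatPairs n
  have hbra := vacBra_PsiDag_mul_PsiDag n (expBeta d * expBetaHat e * (T * U'))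
  rw [← mul_assoc] at hbra
  rw [Module.End.mul_apply, Module.End.mul_apply, hTv, hUv]
  by_cases hn : Even n
  · rw [(ZMod.natCast_eq_zero_iff_even).2 (Int.natAbs_even.2 hn)] at hP
    rw [vev_factor_even hP hP hC hD hT hT₁ hU₁ hTv hUv'] at hbra
    rw [← I_zpow_even hn, ← hbra, braB, if_pos hn]
    rfl
  · rw [Int.not_even_iff_odd] at hn
    rw [(ZMod.natCast_eq_one_iff_odd).2 (Int.natAbs_odd.2 hn)] at hP
    rw [vev_factor_odd hP hP hC hD hT hT₁ hU₁ hTv hUv'] at hbra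
    -- The two factors √2 from ⟨n| give 2, against the 2i of the inserted zero modes; the quotient
    -- is -i.
    have h2 : ((Real.sqrt 2 : ℝ) : ℂ) * ((Real.sqrt 2 : ℝ) : ℂ) = 2 := by
      rw [← Complex.ofReal_mul, Real.mul_self_sqrt (by norm_num)]; norm_num
    have hb (X : Op) : braB n (X vac) =
        ((Real.sqrt 2 : ℝ) : ℂ) * vev (b 0 * PsiDag psi psiDag n * X) := by
      rw [braB, if_neg (Int.not_even_iff_odd.2 hn), phi_eq]
      simp [vev, Module.End.mul_apply]
    rw [hb, hb, ← I_zpow_odd hn]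
    linear_combination (vev (b 0 * PsiDag psi psiDag n * T₁) *
      vev (b 0 * PsiDag psi psiDag n * U₁)) * (h2 + 2 * Complex.I_mul_I) - Complex.I * hbra

lemma braB_mem_finFunctionals (n : ℤ) : braB n ∈ finFunctionals := by
  have h := mem_rowFinite_of_mem_hatPairs (PsiDag_mem_hatPairs n)
  rw [braB]
  split_ifs
  · exact vacBra_comp_mem h
  · rw [phi_eq]
    exact vacBra_comp_mem (Subalgebra.smul_mem _ (Subalgebra.mul_mem _ (b_mem_rowFinite 0) h) _)

lemma PsiDag_mem_rowFinite {x y : ℤ → Op} (h : IsFermionPair x y) (n : ℤ) :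
    PsiDag x y n ∈ rowFinite := by
  unfold PsiDag
  split_ifs <;> refine Subalgebra.list_prod_mem _ fun z hz => ?_ <;>
    obtain ⟨k, _, rfl⟩ := List.mem_map.1 hz
  exacts [h.right_rowFinite _, h.left_rowFinite _]

lemma bra2_mem_finFunctionals (n m : ℤ) : bra2 n m ∈ finFunctionals :=
  vacBra_comp_mem (Subalgebra.mul_mem _ (PsiDag_mem_rowFinite isFermionPair_psi1 n)
    (PsiDag_mem_rowFinite isFermionPair_psi2 m))

lemma expBeta_mem_rowFinite (d : ℕ+ →₀ ℕ) : expBeta d ∈ rowFinite :=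
  coeff_expSeries_mem (fun k => isFermionPair_psi.oscillator_mem_rowFinite (PNat.intCast_pos k)) d

/-- The coefficients of `exp (∑ (t^(1)_k α^(1)_k + t^(2)_k α^(2)_k))`. -/
def expAlpha (e : ℕ+ ⊕ ℕ+ →₀ ℕ) : Op := coeff e (expSeries
  (Sum.elim (fun k : ℕ+ => alpha1 ((k : ℕ) : ℤ)) (fun k : ℕ+ => alpha2 ((k : ℕ) : ℤ))))

lemma expAlpha_mem_rowFinite (e : ℕ+ ⊕ ℕ+ →₀ ℕ) : expAlpha e ∈ rowFinite := by
  refine coeff_expSeries_mem (fun k => ?_) e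
  rcases k with k | k
  · exact isFermionPair_psi1.oscillator_mem_rowFinite (PNat.intCast_pos k)
  · exact isFermionPair_psi2.oscillator_mem_rowFinite (PNat.intCast_pos k)

lemma sum_expAlpha (d : ℕ+ →₀ ℕ) :
    ∑ e ∈ doubleFiber d, mergeSign e • expAlpha e =
      ∑ p ∈ Finset.HasAntidiagonal.antidiagonal d, expBeta p.1 * expBetaHat p.2 := by
  refine (sum_doubleFiber_coeff_expSeries _ _ d).trans ?_
  rw [← funext fun k : ℕ+ => beta_add_betaHat (PNat.intCast_pos k)]
  exact coeff_expSeries_add (fun k l =>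
    commute_beta_betaHat (PNat.intCast_pos k) (PNat.intCast_pos l)) d

lemma ConvergesOnVacuum.summable_mul_apply {ι : Type} {T : ι → Op} (hT : ConvergesOnVacuum T)
    {u : Fock →ₗ[ℂ] ℂ} (hu : u ∈ finFunctionals) {X : Op} (hX : X ∈ rowFinite) :
    Summable fun i => u ((X * T i) vac) := by
  have := hT.summable (hX u hu)
  simpa only [LinearMap.comp_apply, Module.End.mul_apply] using this

lemma coeff_expectation {σ ι : Type} (u : Fock →ₗ[ℂ] ℂ) (H : σ → Op) (T : ι → Op) (d : σ →₀ ℕ) :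
    coeff d (expectation u H T) = ∑' i, u ((coeff d (expSeries H) * T i) vac) := rfl

lemma coeff_tauB {ι : Type} (T : ι → Op) (n : ℤ) (d : ℕ+ →₀ ℕ) :
    coeff d (tauB T n) = ∑' i, braB n ((expBeta d * T i) vac) := by
  rw [tauB, coeff_expectation, expBeta]

lemma coeff_tau0 {ι : Type} (T : ι → Op) (n : ℤ) (e : ℕ+ ⊕ ℕ+ →₀ ℕ) :
    coeff e (tau0 T n) = ∑' i, bra2 n (-n) ((expAlpha e * T i) vac) := by
  rw [tau0, coeff_expectation, expAlpha]

/-- This is the whole identity for a single pair of terms of the expansions of h and ĥ. The two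
terms are independent because squaring τ^B_n produces all cross terms. -/
lemma sum_braB_mul_braB {T T' U U' : Op} (hT : (T, T') ∈ hatPairs 0) (hU : (U, U') ∈ hatPairs 0)
    (n : ℤ) (d : ℕ+ →₀ ℕ) :
    ∑ p ∈ Finset.HasAntidiagonal.antidiagonal d,
      braB n ((expBeta p.1 * T) vac) * braB n ((expBeta p.2 * U) vac) =
      (-1 : ℂ) ^ (n * (n - 1) / 2) *
        ∑ e ∈ doubleFiber d, mergeSign e * bra2 n (-n) ((expAlpha e * (T * U')) vac) := by
  rw [Finset.sum_congr rfl fun p _ => braB_mul_braB hT hU n p.1 p.2, ← Finset.mul_sum]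
  congr 1
  have h := congrArg (fun X : Op => bra2 n (-n) ((X * (T * U')) vac)) (sum_expAlpha d)
  simp only [Finset.sum_mul, smul_mul_assoc, LinearMap.sum_apply, map_sum, LinearMap.smul_apply,
    map_smul, smul_eq_mul] at h
  exact h.symm

lemma sum_tsum_mul_tsum {ι κ : Type} (s : Finset κ) (F G : κ → ι → ℂ)
    (hF : ∀ p, Summable (F p)) (hG : ∀ p, Summable (G p)) :
    ∑ p ∈ s, (∑' i, F p i) * (∑' i, G p i) =
      ∑' i : ι × ι, ∑ p ∈ s, F p i.1 * G p i.2 := by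
  rw [Summable.tsum_finsetSum fun p _ => summable_mul (hF p) (hG p)]
  exact Finset.sum_congr rfl fun p _ =>
    tsum_mul_tsum_of_summable_norm (hF p).norm (hG p).norm

lemma sum_mul_tsum {ι κ : Type} (s : Finset κ) (c : κ → ℂ) (F : κ → ι → ℂ)
    (hF : ∀ e, Summable (F e)) :
    ∑ e ∈ s, c e * ∑' i, F e i = ∑' i, ∑ e ∈ s, c e * F e i := by
  rw [Summable.tsum_finsetSum fun e _ => (hF e).mul_left (c e)]
  exact Finset.sum_congr rfl fun e _ => tsum_mul_left.symm

theorem tauB_sq {ι : Type} {T T' : ι → Op} (hT : ConvergesOnVacuum T)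
    (hp : ∀ i, (T i, T' i) ∈ hatPairs 0) (n : ℤ) :
    (tauB T n) ^ 2 = ((-1 : ℂ) ^ (n * (n - 1) / 2)) •
      MvPowerSeries.subst plusMinus (tau0 (familyMul T T') n) := by
  have hg := convergesOnVacuum_familyMul hT hp
  have hsB (d : ℕ+ →₀ ℕ) : Summable fun i => braB n ((expBeta d * T i) vac) :=
    hT.summable_mul_apply (braB_mem_finFunctionals n) (expBeta_mem_rowFinite d)
  have hsA (e : ℕ+ ⊕ ℕ+ →₀ ℕ) :
      Summable fun i : ι × ι => bra2 n (-n) ((expAlpha e * familyMul T T' i) vac) :=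
    hg.summable_mul_apply (bra2_mem_finFunctionals n (-n)) (expAlpha_mem_rowFinite e)
  ext1 d
  rw [sq, coeff_mul, map_smul, coeff_subst_plusMinus, smul_eq_mul]
  simp only [coeff_tauB, coeff_tau0]
  -- Absolute convergence turns both sides into sums over pairs of words, which agree term by term.
  rw [sum_tsum_mul_tsum _ (fun p : (ℕ+ →₀ ℕ) × (ℕ+ →₀ ℕ) => fun i => braB n ((expBeta p.1 * T i) vac))
    (fun p i => braB n ((expBeta p.2 * T i) vac)) (fun p => hsB p.1) (fun p => hsB p.2),
    sum_mul_tsum _ mergeSign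
      (fun e (i : ι × ι) => bra2 n (-n) ((expAlpha e * familyMul T T' i) vac)) hsA,
    ← tsum_mul_left]
  exact tsum_congr fun i => sum_braB_mul_braB (hp i.1) (hp i.2) n d

end TauFunctions

end LargeBKP

end

open LargeBKP
theorem mainTheorem1 (r : ℕ) (A : Fin r → ℤ → ℤ → ℂ)
    (hA : ConvergesOnVacuum (groupElement b A)) :
    ConvergesOnVacuum (familyMul (groupElement b A) (groupElement bHat A)) ∧
    ∀ n : ℤ,
      (tauB (groupElement b A) n) ^ 2 =
        ((-1 : ℂ) ^ (n * (n - 1) / 2)) •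
          MvPowerSeries.subst plusMinus
            (tau0 (familyMul (groupElement b A) (groupElement bHat A)) n) :=
  ⟨convergesOnVacuum_familyMul hA (groupElement_mem_hatPairs A),
    tauB_sq hA (groupElement_mem_hatPairs A)⟩
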